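/- **Setting.** For $z,w\in\mathbb C^n$ write $z\cdot w=\sum_j z_jw_j$, $z^2=z\cdot z$, $|z|^2=\sum_j|z_j|^2$ (and similarly on $\mathbb R^n$). Let $F^2(\mathbb C^n)$ be the Fock space of entire functions that are square integrable for $dg_n(z)=\pi^{-n}e^{-|z|^2}d\nu_{2n}(z)$, where $\nu_d$ is Lebesgue measure on $\mathbb R^d$ and $\mathbb C^n\simeq\mathbb R^{2n}$; its reproducing kernel is $K_z(w)=e^{\bar z\cdot w}$. The Bargmann transform $B:F^2(\mathbb C^n)\to L_2(\mathbb R^n)$ is the unitary operator whose adjoint is $$(B^*\varphi)(z)=\pi^{-n/4}\int_{\mathbb R^n}\varphi(x)\,e^{\sqrt2\,x\cdot z-\frac{x^2}{2}-\frac{z^2}{2}}\,dx .$$ A complex regular Borel measure is a complex-valued Borel measure $\mu$, $d\mu=h\,d|\mu|$ with $|h|=1$, whose total variation $|\mu|$ is locally finite (not necessarily finite). For $k\in(\mathbb Z_+/2)^n$, such a measure on $\mathbb C^n$ is called $k$-FC if $$(k!)^2\sup_{z\in\mathbb C^n}\int_{D(z)}\prod_{j=1}^n(1+x_j^2)^{k_j}(1+y_j^2)^{k_j}\,d|\mu|(x+iy)<\infty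 ,$$ where $D(z)=\{w:|w_j-z_j|<1,\ 1\le j\le n\}$ and $k!=\prod_j\Gamma(k_j+1)$. For a multi-index $\alpha$, $\partial^\alpha$ is the complex derivative. Put $$\mathfrak F_{\mu,2k}(f,g)=\sum_{\beta\le 2k}\binom{2k}{\beta}\,\pi^{-n}\int_{\mathbb C^n}\partial^{2k-\beta}f(w)\,\overline{\partial^{\beta}g(w)}\,e^{-|w|^2}\,d\mu(w).$$ The Toeplitz operator $T_{\partial_R^{2k}\mu}$ of the real coderivative $\partial_R^{2k}\mu$ is the operator generated by this form: $(T_{\partial_R^{2k}\mu}f)(z)=\mathfrak F_{\mu,2k}(f,K_z)$. **Theorem 5.2 (diagonalization of $T_{\partial_R^{2k}\mu}$).** Let $k\in(\mathbb Z_+/2)^n$, let $\varrho$ be a complex regular Borel measure on $\mathbb R^n$, let $\mu=\varrho\otimes\nu_n$ be the corresponding horizontal measure on $\mathbb C^n=\mathbb R^n+i\mathbb R^n$, and let $$\gamma_{\varrho,2k}(x)=\Big(\frac2\pi\Big)^{n/2}\int_{\mathbb R^n}H^{(n)}_{2k}(\sqrt2\,x-y)\,e^{-(x-\sqrt2\,y)^2}\,d\varrho(y),\qquad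 H^{(n)}_m(t)=\prod_{j=1}^n(-1)^{m_j}e^{t_j^2}\frac{d^{m_j}}{dt_j^{m_j}}e^{-t_j^2}.$$ (a) If $\mu$ is $k$-FC, then the integrals defining $\mathfrak F_{\mu,2k}(f,g)$, for $f,g\in F^2(\mathbb C^n)$, and $\gamma_{\varrho,2k}(x)$, for $x\in\mathbb R^n$, converge absolutely; $T_{\partial_R^{2k}\mu}$ is a bounded operator on $F^2(\mathbb C^n)$ with $\langle T_{\partial_R^{2k}\mu}f,g\rangle=\mathfrak F_{\mu,2k}(f,g)$ for all $f,g$; $\gamma_{\varrho,2k}\in L_\infty(\mathbb R^n)$; and $$B\,T_{\partial_R^{2k}\mu}\,B^*=\gamma_{\varrho,2k}\,I,$$ the operator of multiplication by $\gamma_{\varrho,2k}$ on $L_2(\mathbb R^n)$. (b) The same diagonalization holds for every horizontal measure $\mu=\varrho\otimes\nu_n$, $k$-FC or not, for which the form makes sense on the kernel functions and generates a bounded operator: if $\int_{\mathbb C^n}|K_z(w)|^2e^{-|w|^2}d|\mu|(w)<\infty$ for every $z\in\mathbb C^n$, then the integrals defining $\gamma_{\varrho,2k}(x)$ converge absolutely,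 and every bounded operator $T$ on $F^2(\mathbb C^n)$ with $(TK_w)(z)=\mathfrak F_{\mu,2k}(K_w,K_z)$ for all $z,w\in\mathbb C^n$ satisfies $BTB^*=\gamma_{\varrho,2k}\,I$, with $\gamma_{\varrho,2k}\in L_\infty(\mathbb R^n)$. -/

import Mathlib

open MeasureTheory

noncomputable section

namespace FockToeplitz

/-! ### Complex Radon measures

A complex-valued regular Borel measure with locally finite (but possibly infinite) total variation.
It is given by its polar decomposition `dμ = phase d|μ|`, with `|phase| = 1`. On the spaces
`ℝⁿ` and `ℂⁿ` used below a locally finite positive Borel measure is automatically regular. -/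

structure ComplexRadonMeasure (X : Type) [TopologicalSpace X] [MeasurableSpace X] where
  /-- the total variation `|μ|` -/
  variation : Measure X
  /-- the unimodular density of `μ` with respect to `|μ|` -/
  phase : X → ℂ
  isLocallyFinite : IsLocallyFiniteMeasure variation
  measurable_phase : Measurable phase
  norm_phase : ∀ x, ‖phase x‖ = 1

namespace ComplexRadonMeasure

variable {X : Type} [TopologicalSpace X] [MeasurableSpace X]

/-- `∫ f dμ`. -/
def integral (μ : ComplexRadonMeasure X) (f : X → ℂ) : ℂ :=
  ∫ x, f x * μ.phase x ∂μ.variation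

/-- The complex number `μ(A)` (meaningful whenever `|μ|(A) < ∞`). -/
def value (μ : ComplexRadonMeasure X) (A : Set X) : ℂ :=
  ∫ x in A, μ.phase x ∂μ.variation

end ComplexRadonMeasure

/-! ### Horizontal measures -/

/-- The identification `ℝⁿ × ℝⁿ ≃ ℂⁿ`, `(x, y) ↦ x + iy`. -/
def toComplexHomeo (n : ℕ) : ((Fin n → ℝ) × (Fin n → ℝ)) ≃ₜ (Fin n → ℂ) where
  toFun p := fun j => ⟨p.1 j, p.2 j⟩
  invFun z := (fun j => (z j).re, fun j => (z j).im)
  left_inv _ := rfl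
  right_inv _ := rfl
  continuous_toFun := by
    refine continuous_pi fun j => ?_
    have h : Continuous fun p : (Fin n → ℝ) × (Fin n → ℝ) =>
        Complex.equivRealProdCLM.symm (p.1 j, p.2 j) := by fun_prop
    exact h
  continuous_invFun := by
    refine Continuous.prodMk ?_ ?_
    · exact continuous_pi fun j => Complex.continuous_re.comp (continuous_apply j)
    · exact continuous_pi fun j => Complex.continuous_im.comp (continuous_apply j)

/-- The horizontal measure `ϱ ⊗ νₙ` on `ℂⁿ = ℝⁿ + iℝⁿ`, with `νₙ` the Lebesgue measure on `ℝⁿ`. -/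
def horizontal {n : ℕ} (ϱ : ComplexRadonMeasure (Fin n → ℝ)) :
    ComplexRadonMeasure (Fin n → ℂ) where
  variation := (ϱ.variation.prod volume).map (toComplexHomeo n)
  phase := fun z => ϱ.phase fun j => (z j).re
  isLocallyFinite := by
    have := ϱ.isLocallyFinite
    have := MeasureTheory.Measure.IsFiniteMeasureOnCompacts.map (ϱ.variation.prod volume) (toComplexHomeo n)
    infer_instance
  measurable_phase := ϱ.measurable_phase.comp
    (measurable_pi_lambda _ fun j => Complex.measurable_re.comp (measurable_pi_apply j))
  norm_phase := fun _ => ϱ.norm_phase _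

/-- `(ϱ ⊗ νₙ)(A + iB) = ϱ(A) νₙ(B)`. -/
theorem horizontal_value_box {n : ℕ} (ϱ : ComplexRadonMeasure (Fin n → ℝ))
    (A B : Set (Fin n → ℝ)) :
    (horizontal ϱ).value (toComplexHomeo n '' (A ×ˢ B)) = ϱ.value A * ((volume B).toReal : ℂ) := by
  have := ϱ.isLocallyFinite
  unfold ComplexRadonMeasure.value horizontal
  have hE : MeasurableEmbedding (toComplexHomeo n) := (toComplexHomeo n).measurableEmbedding
  rw [hE.setIntegral_map, Set.preimage_image_eq _ (toComplexHomeo n).injective,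
    ← Measure.prod_restrict]
  have h := integral_prod_mul (μ := ϱ.variation.restrict A)
    (ν := (volume : Measure (Fin n → ℝ)).restrict B) (L := ℂ) ϱ.phase (fun _ => 1)
  simpa [toComplexHomeo, Measure.real] using h

/-! ### The Fock space -/

/-- `|z|² = ∑ⱼ |zⱼ|²`. -/
def sqNorm {n : ℕ} (z : Fin n → ℂ) : ℝ := ∑ j, ‖z j‖ ^ 2

/-- The Gaussian measure `dgₙ(z) = π⁻ⁿ e^{-|z|²} dν₂ₙ(z)`. -/
def gauss (n : ℕ) : Measure (Fin n → ℂ) :=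
  (volume : Measure (Fin n → ℂ)).withDensity
    fun z => ENNReal.ofReal ((Real.pi ^ n)⁻¹ * Real.exp (-sqNorm z))

/-- The Fock space: the classes in `L₂(ℂⁿ, dgₙ)` that contain an entire function. -/
def Fock (n : ℕ) : Submodule ℂ (Lp ℂ 2 (gauss n)) where
  carrier := {f | ∃ F : (Fin n → ℂ) → ℂ, Differentiable ℂ F ∧ f =ᵐ[gauss n] F}
  zero_mem' := ⟨0, differentiable_const 0, Lp.coeFn_zero ℂ 2 (gauss n)⟩
  add_mem' := by
    rintro f g ⟨F, hF, hf⟩ ⟨G, hG, hg⟩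
    exact ⟨F + G, hF.add hG, (Lp.coeFn_add f g).trans (hf.add hg)⟩
  smul_mem' := by
    rintro c f ⟨F, hF, hf⟩
    refine ⟨c • F, hF.const_smul c, (Lp.coeFn_smul c f).trans ?_⟩
    filter_upwards [hf] with z hz
    simp [hz]

/-- The entire function representing an element of the Fock space (it is unique, because `gₙ`
charges every nonempty open set). -/
def entire {n : ℕ} (f : Fock n) : (Fin n → ℂ) → ℂ := Classical.choose f.2

/-- The reproducing kernel `K_z(w) = e^{z̄ · w}`. -/
def kernel {n : ℕ} (z w : Fin n → ℂ) : ℂ := Complex.exp (∑ j, star (z j) * w j)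

/-! ### The Bargmann transform -/

/-- `(B* φ)(z) = π^{-n/4} ∫ φ(x) e^{√2 x·z - x²/2 - z²/2} dx`. -/
def bargmannStar {n : ℕ} (φ : (Fin n → ℝ) → ℂ) (z : Fin n → ℂ) : ℂ :=
  ((Real.pi ^ (-(n : ℝ) / 4) : ℝ) : ℂ) *
    ∫ x : Fin n → ℝ, φ x *
      Complex.exp (∑ j, ((Real.sqrt 2 : ℂ) * (x j : ℂ) * z j - (x j : ℂ) ^ 2 / 2 - z j ^ 2 / 2))

/-- `B` is the (unitary) Bargmann transform from the Fock space onto `L₂(ℝⁿ)`: its adjoint, that is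
its inverse, is given by the integral formula above. -/
def IsBargmann {n : ℕ}
    (B : Fock n ≃ₗᵢ[ℂ] Lp ℂ 2 (volume : Measure (Fin n → ℝ))) : Prop :=
  ∀ (φ : Lp ℂ 2 (volume : Measure (Fin n → ℝ))) (z : Fin n → ℂ),
    entire (B.symm φ) z = bargmannStar φ z

/-! ### Fock-Carleson measures of order `k` -/

/-- `|μ_k|(A) = ∫_A ∏ⱼ (1 + xⱼ²)^{kⱼ} (1 + yⱼ²)^{kⱼ} d|μ|(x + iy)`. -/
def weightedVariation {n : ℕ} (k : Fin n → ℝ) (μ : ComplexRadonMeasure (Fin n → ℂ)) :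
    Measure (Fin n → ℂ) :=
  μ.variation.withDensity fun z =>
    ENNReal.ofReal (∏ j, (1 + (z j).re ^ 2) ^ k j * (1 + (z j).im ^ 2) ^ k j)

/-- `μ` is a Fock-Carleson type measure for derivatives of (half-integer) order `k`:
`(k!)² sup_z |μ_k|(D(z)) < ∞`, where `D(z)` is the polydisk with centre `z` and radii `1`,
and `k! = ∏ⱼ Γ(kⱼ + 1)`. -/
def IsKFC {n : ℕ} (k : Fin n → ℝ) (μ : ComplexRadonMeasure (Fin n → ℂ)) : Prop :=
  ENNReal.ofReal ((∏ j, Real.Gamma (k j + 1)) ^ 2) *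
    (⨆ z : Fin n → ℂ, weightedVariation k μ {w | ∀ j, ‖w j - z j‖ < 1}) < ⊤

/-! ### Coderivatives and their sesquilinear forms -/

/-- The complex partial derivative `∂^α = ∂₁^{α₁} ⋯ ∂ₙ^{αₙ}`. -/
def cderiv {n : ℕ} (α : Fin n → ℕ) (f : (Fin n → ℂ) → ℂ) : (Fin n → ℂ) → ℂ :=
  (List.finRange n).foldr
    (fun j g => (fun (h : (Fin n → ℂ) → ℂ) z => lineDeriv ℂ h z (Pi.single j 1))^[α j] g) f

/-- `∂^α f · conj (∂^β g) · e^{-|z|²}`. -/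
def coderivIntegrand {n : ℕ} (α β : Fin n → ℕ) (f g : (Fin n → ℂ) → ℂ) (z : Fin n → ℂ) : ℂ :=
  cderiv α f z * star (cderiv β g z) * (Real.exp (-sqNorm z) : ℂ)

/-- The form `F_{μ,α,β}(f, g) = π⁻ⁿ ∫ ∂^α f · conj (∂^β g) · e^{-|z|²} dμ(z)`. -/
def coderivForm {n : ℕ} (μ : ComplexRadonMeasure (Fin n → ℂ)) (α β : Fin n → ℕ)
    (f g : (Fin n → ℂ) → ℂ) : ℂ :=
  ((Real.pi : ℂ) ^ n)⁻¹ * μ.integral (coderivIntegrand α β f g)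

/-- The form of the real coderivative `∂_R^m μ`, `m = 2k`:
`𝔉_{μ,m} = ∑_{β ≤ m} (m choose β) F_{μ,m-β,β}`. -/
def realCoderivForm {n : ℕ} (μ : ComplexRadonMeasure (Fin n → ℂ)) (m : Fin n → ℕ)
    (f g : (Fin n → ℂ) → ℂ) : ℂ :=
  ∑ β ∈ Finset.Icc 0 m, ((∏ j, (m j).choose (β j) : ℕ) : ℂ) * coderivForm μ (m - β) β f g

/-! ### The spectral function -/

/-- The product of Hermite polynomials
`H_m^{(n)}(t) = ∏ⱼ (-1)^{mⱼ} e^{tⱼ²} (d/dtⱼ)^{mⱼ} e^{-tⱼ²}`. -/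
def hermiteProd {n : ℕ} (m : Fin n → ℕ) (t : Fin n → ℝ) : ℝ :=
  ∏ j, (-1) ^ m j * Real.exp (t j ^ 2) * iteratedDeriv (m j) (fun s : ℝ => Real.exp (-s ^ 2)) (t j)

/-- `H_m^{(n)}(√2 x - y) e^{-(x - √2 y)²}`. -/
def gammaIntegrand {n : ℕ} (m : Fin n → ℕ) (x y : Fin n → ℝ) : ℂ :=
  ((hermiteProd m (fun j => Real.sqrt 2 * x j - y j) *
    Real.exp (-∑ j, (x j - Real.sqrt 2 * y j) ^ 2) : ℝ) : ℂ)

/-- `γ_{ϱ,m}(x) = (2/π)^{n/2} ∫ H_m^{(n)}(√2 x - y) e^{-(x - √2 y)²} dϱ(y)`. -/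
def gammaFn {n : ℕ} (ϱ : ComplexRadonMeasure (Fin n → ℝ)) (m : Fin n → ℕ) (x : Fin n → ℝ) : ℂ :=
  (((2 / Real.pi) ^ ((n : ℝ) / 2) : ℝ) : ℂ) * ϱ.integral (gammaIntegrand m x)

/-- `S` is unitarily equivalent, through `B`, to multiplication by the `L∞` function `γ`:
`B S B* = γ I`. -/
def IsDiagonalizedBy {n : ℕ} (B : Fock n ≃ₗᵢ[ℂ] Lp ℂ 2 (volume : Measure (Fin n → ℝ)))
    (S : Fock n →L[ℂ] Fock n) (γ : (Fin n → ℝ) → ℂ) : Prop :=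
  MemLp γ ⊤ volume ∧
    ∀ φ : Lp ℂ 2 (volume : Measure (Fin n → ℝ)),
      (B (S (B.symm φ)) : (Fin n → ℝ) → ℂ) =ᵐ[volume] fun x => γ x * φ x

end FockToeplitz

end

open FockToeplitz

/-!
# Diagonalization of Toeplitz operators with real coderivatives of horizontal measures as symbols

Let `e_a(x) = π^{-n/4} exp(√2 x·a - x²/2 - a²/2)` be the kernel of `B*` (`coherent a`). Everything
rests on testing operators against these coherent states.

**The Bargmann transform.** Since `∫ e_a e_b = e^{a·b}`, the vectors `e_{w̄}` of `L₂(ℝⁿ)` and `K_w`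
of the Fock space have the same Gram matrix, and `B* e_{w̄} = K_w`. The functions `e_a` span a dense
subspace, because pairing with them contains the Fourier transform of the product with a Gaussian
(`ae_eq_zero_of_coherent`). Hence `B*` extends isometrically, by Fatou's lemma, to all of `L₂(ℝⁿ)`
(`norm_bargmannCLM`), and it is onto because the kernels `K_w` are total in the Fock space
(`surjective_bargmannCLM`). The latter is the reproducing property (`inner_kernelFock`), a mean value
property for the rotation invariant Gaussian measure (`integral_eq_of_rotation_invariant`).

**The spectral function.** With `a = w̄`, `b = z` one computes
`𝔉(K_w, K_z) = π^{-n/2} (a + b)^m e^{-(a - b)²/4} ∫ e^{(a + b)·y - y²} dϱ(y)`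
(`realCoderivForm_kernel`), and Fubini's theorem together with the Laplace transform of
`H_m(t) e^{-t²}` gives the same value for `∫ γ e_a e_b` (`integral_gammaFn_mul_coherent`). So
`B T B* e_a` and `γ e_a` have the same pairing with every `e_b` and coincide; a bounded operator that
agrees with multiplication by `γ` on the coherent states is this multiplication, and `γ` is bounded
(`eq_mul_of_coherentLp`). All that is needed of `ϱ` is that `∫ e^{c·y - y²} d|ϱ|(y) < ∞` for every
real `c`, which is equivalent to square integrability of the kernels `K_z` for `e^{-|w|²} d|μ|`.

**Boundedness of the form.** For an arbitrary `k`-FC measure `μ`, horizontal or not, Cauchy's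
inequality on small circles bounds `|∂^α f(z)| e^{-|z|²/2}` by `∏ (1 + |zⱼ|)^{αⱼ}` times the `L₂(gₙ)`
norm of `f` on the unit polydisk about `z` (`exists_enorm_cderiv_le`). The weight in the definition of
`k`-FC measures absorbs the product of two such factors, and the Cauchy-Schwarz inequality and
Tonelli's theorem finish the estimate (`IsKFC.exists_lintegral_le`). The operator `T` then comes from
the Riesz representation theorem.
-/

noncomputable section

namespace FockToeplitz

open Filter Topology

/-! ### Entire functions of several variables -/

/-- An integral of entire functions depending on a parameter is entire, as soon as the integrand is
locally dominated. The bound on the derivative needed for differentiating under the integral sign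
comes from the Schwarz lemma, so that only the integrand itself has to be estimated. -/
theorem differentiable_integral_mul {n : ℕ} {X : Type*} [TopologicalSpace X]
    [SecondCountableTopology X] [MeasurableSpace X] [BorelSpace X] {ν : Measure X}
    {φ : X → ℂ} (hφ : AEStronglyMeasurable φ ν) {k : X → (Fin n → ℂ) → ℂ}
    (hk : Continuous (Function.uncurry k)) (hd : ∀ x, Differentiable ℂ (k x))
    (hb : ∀ z₀ : Fin n → ℂ, ∃ b : X → ℝ, Integrable b ν ∧
      ∀ z ∈ Metric.ball z₀ 2, ∀ x, ‖φ x * k x z‖ ≤ b x) :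
    Differentiable ℂ fun z => ∫ x, φ x * k x z ∂ν := by
  intro z₀
  obtain ⟨b, hbi, hb⟩ := hb z₀
  have hmeas : ∀ z, AEStronglyMeasurable (fun x => φ x * k x z) ν := fun z =>
    hφ.mul (hk.comp (Continuous.prodMk_left z)).aestronglyMeasurable
  have hderiv : ∀ x z, HasFDerivAt (fun z => φ x * k x z) (φ x • fderiv ℂ (k x) z) z :=
    fun x z => (hd x z).hasFDerivAt.const_mul (φ x)
  refine (hasFDerivAt_integral_of_dominated_of_fderiv_le (𝕜 := ℂ)
    (F := fun z x => φ x * k x z) (F' := fun z x => φ x • fderiv ℂ (k x) z)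
    (bound := fun x => 2 * b x) (s := Metric.ball z₀ 1) (Metric.ball_mem_nhds z₀ one_pos)
    (Eventually.of_forall hmeas) ?_ ?_ ?_ (hbi.const_mul 2) ?_).differentiableAt
  · exact hbi.mono' (hmeas z₀) (Eventually.of_forall (hb z₀ (by simp)))
  · refine hφ.smul (Measurable.aestronglyMeasurable ?_)
    exact (measurable_fderiv_with_param ℂ hk).comp (measurable_id.prodMk measurable_const)
  · refine Eventually.of_forall fun x z hz => ?_
    rw [← (hderiv x z).fderiv]
    have h2 : ∀ w ∈ Metric.ball z 1, w ∈ Metric.ball z₀ 2 := fun w hw => by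
      simp only [Metric.mem_ball] at *
      linarith [dist_triangle w z z₀]
    have := Complex.norm_fderiv_le_div_of_mapsTo_ball (f := fun z => φ x * k x z) (c := z)
      (R₁ := 1) (R₂ := 2 * b x) (fun w _ => (hderiv x w).differentiableAt.differentiableWithinAt)
      (fun w hw => ?_) one_pos
    · simpa using this
    · rw [Metric.mem_closedBall, dist_eq_norm]
      refine (norm_sub_le _ _).trans ?_
      linarith [hb w (h2 w hw) x, hb z (h2 z (by simp)) x]
  · exact Eventually.of_forall fun x z _ => hderiv x z

/-- The complex partial derivative `∂ⱼ`. -/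
def partialDeriv {n : ℕ} (j : Fin n) (f : (Fin n → ℂ) → ℂ) (z : Fin n → ℂ) : ℂ :=
  lineDeriv ℂ f z (Pi.single j 1)

theorem partialDeriv_eq_deriv {n : ℕ} (j : Fin n) (f : (Fin n → ℂ) → ℂ) (z : Fin n → ℂ) :
    partialDeriv j f z = deriv (fun ζ : ℂ => f (z + ζ • Pi.single j 1)) 0 := rfl

theorem differentiable_line {n : ℕ} {f : (Fin n → ℂ) → ℂ} (hf : Differentiable ℂ f)
    (z v : Fin n → ℂ) : Differentiable ℂ fun ζ : ℂ => f (z + ζ • v) :=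
  hf.comp (by fun_prop)

/-- A partial derivative of an entire function is entire: it is an average of translates of the
function over a circle. -/
theorem differentiable_partialDeriv {n : ℕ} (j : Fin n) {f : (Fin n → ℂ) → ℂ}
    (hf : Differentiable ℂ f) : Differentiable ℂ (partialDeriv j f) := by
  set v : Fin n → ℂ := Pi.single j 1
  have hrep : partialDeriv j f = fun z => ∫ θ in Set.Ioc 0 (2 * Real.pi),
      ((2 * Real.pi * Complex.I : ℂ)⁻¹ * (circleMap 0 1 θ * Complex.I) *
        (1 / circleMap 0 1 θ ^ 2)) * f (z + circleMap 0 1 θ • v) := by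
    funext z
    have hc := Complex.two_pi_I_inv_smul_circleIntegral_sub_sq_inv_smul_of_differentiable
      (R := 1) (c := 0) isOpen_univ (Set.subset_univ _) (differentiable_line hf z v).differentiableOn
      (Metric.mem_ball_self one_pos)
    rw [partialDeriv_eq_deriv, ← hc, circleIntegral,
      intervalIntegral.integral_of_le (by positivity), smul_eq_mul, ← integral_const_mul]
    refine integral_congr_ae (Eventually.of_forall fun θ => ?_)
    simp only [deriv_circleMap, smul_eq_mul, sub_zero, one_div]
    ring
  have hcm : Continuous fun θ : ℝ => (circleMap 0 1 θ : ℂ) := continuous_circleMap 0 1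
  have hne : ∀ θ : ℝ, (circleMap 0 1 θ : ℂ) ^ 2 ≠ 0 := fun θ => by simp
  rw [hrep]
  refine differentiable_integral_mul (k := fun θ z => f (z + circleMap 0 1 θ • v)) ?_ ?_ ?_ ?_
  · refine Continuous.aestronglyMeasurable ?_
    exact (continuous_const.mul (hcm.mul continuous_const)).mul
      (continuous_const.div (hcm.pow 2) hne)
  · exact hf.continuous.comp (by fun_prop)
  · exact fun θ => hf.comp (by fun_prop)
  · intro z₀
    obtain ⟨C, hC⟩ := (isCompact_closedBall z₀ (2 + ‖v‖)).exists_bound_of_continuousOn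
      hf.continuous.continuousOn
    refine ⟨fun _ => ‖(2 * Real.pi * Complex.I : ℂ)⁻¹‖ * C, integrable_const _, fun z hz θ => ?_⟩
    have h1 : ‖(circleMap 0 1 θ : ℂ)‖ = 1 := by simp
    have h2 : ‖f (z + circleMap 0 1 θ • v)‖ ≤ C := by
      refine hC _ ?_
      rw [Metric.mem_closedBall, dist_eq_norm]
      calc ‖z + circleMap 0 1 θ • v - z₀‖ = ‖(z - z₀) + circleMap 0 1 θ • v‖ := by
            congr 1; abel
        _ ≤ ‖z - z₀‖ + ‖circleMap 0 1 θ • v‖ := norm_add_le _ _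
        _ ≤ 2 + ‖v‖ := by
            rw [norm_smul, h1, one_mul]
            have := mem_ball_iff_norm.1 hz
            linarith
    rw [norm_mul, norm_mul, norm_mul, norm_mul, norm_div, norm_pow, h1]
    simp only [Complex.norm_I, norm_one, one_pow, div_one, mul_one]
    gcongr

/-- Induction on the order of the differential operators `∂^α`. -/
theorem cderiv_induction {n : ℕ}
    {P : (Fin n → ℕ) → (((Fin n → ℂ) → ℂ) → (Fin n → ℂ) → ℂ) → Prop} (h0 : P 0 id)
    (hs : ∀ a A j, P a A → P (a + Pi.single j 1) fun f => partialDeriv j (A f))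
    (α : Fin n → ℕ) : P α (cderiv α) := by
  have hit : ∀ a A j m, P a A → P (a + Pi.single j m) fun f => (partialDeriv j)^[m] (A f) := by
    intro a A j m h
    induction m with
    | zero => simpa using h
    | succ m ih =>
      have := hs _ _ j ih
      rw [add_assoc, ← Pi.single_add] at this
      simpa only [Function.iterate_succ_apply'] using this
  have hl : ∀ l : List (Fin n), P (l.map fun j => Pi.single j (α j)).sum fun f =>
      l.foldr (fun j g => (partialDeriv j)^[α j] g) f := by
    intro l
    induction l with
    | nil => exact h0
    | cons j l ih =>
      rw [List.map_cons, List.sum_cons, add_comm]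
      exact hit _ _ j (α j) ih
  have h := hl (List.finRange n)
  rw [← Fin.sum_univ_def, Finset.univ_sum_single] at h
  exact h

theorem differentiable_cderiv {n : ℕ} (α : Fin n → ℕ) {f : (Fin n → ℂ) → ℂ}
    (hf : Differentiable ℂ f) : Differentiable ℂ (cderiv α f) :=
  cderiv_induction (P := fun _ A => ∀ f, Differentiable ℂ f → Differentiable ℂ (A f))
    (fun _ h => h) (fun _ _ j h f hf => differentiable_partialDeriv j (h f hf)) α f hf

theorem cderiv_add {n : ℕ} (α : Fin n → ℕ) {f g : (Fin n → ℂ) → ℂ}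
    (hf : Differentiable ℂ f) (hg : Differentiable ℂ g) :
    cderiv α (f + g) = cderiv α f + cderiv α g := by
  refine (cderiv_induction (P := fun _ A => ∀ f g, Differentiable ℂ f → Differentiable ℂ g →
    (Differentiable ℂ (A f) ∧ Differentiable ℂ (A g)) ∧ A (f + g) = A f + A g)
    (fun _ _ h h' => ⟨⟨h, h'⟩, rfl⟩) (fun _ A j h f g hf hg => ?_) α f g hf hg).2
  obtain ⟨⟨h1, h2⟩, h3⟩ := h f g hf hg
  refine ⟨⟨differentiable_partialDeriv j h1, differentiable_partialDeriv j h2⟩, ?_⟩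
  funext z
  simp only [h3, Pi.add_apply, partialDeriv_eq_deriv]
  exact deriv_fun_add (differentiable_line h1 z _ 0) (differentiable_line h2 z _ 0)

theorem cderiv_smul {n : ℕ} (α : Fin n → ℕ) (c : ℂ) (f : (Fin n → ℂ) → ℂ) :
    cderiv α (c • f) = c • cderiv α f := by
  refine cderiv_induction (P := fun _ A => A (c • f) = c • A f) rfl (fun _ A j h => ?_) α
  funext z
  simp only [h, Pi.smul_apply, partialDeriv_eq_deriv]
  exact deriv_const_smul_field c _

theorem differentiable_kernel {n : ℕ} (w : Fin n → ℂ) : Differentiable ℂ (kernel w) := by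
  unfold kernel
  fun_prop

theorem partialDeriv_kernel {n : ℕ} (j : Fin n) (w z : Fin n → ℂ) :
    partialDeriv j (kernel w) z = star (w j) * kernel w z := by
  rw [partialDeriv_eq_deriv]
  have h : (fun ζ : ℂ => kernel w (z + ζ • Pi.single j 1)) =
      fun ζ : ℂ => Complex.exp (star (w j) * ζ + ∑ i, star (w i) * z i) := by
    funext ζ
    simp only [kernel, Pi.add_apply, Pi.smul_apply, smul_eq_mul, mul_add, Finset.sum_add_distrib,
      Pi.single_apply, mul_ite, mul_one, mul_zero, Finset.sum_ite_eq', Finset.mem_univ, if_true]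
    rw [add_comm]
  rw [h]
  have hd : HasDerivAt (fun ζ : ℂ => Complex.exp (star (w j) * ζ + ∑ i, star (w i) * z i))
      (Complex.exp (star (w j) * 0 + ∑ i, star (w i) * z i) * (star (w j) * 1)) 0 :=
    (((hasDerivAt_id (0 : ℂ)).const_mul (star (w j))).add_const _).cexp
  rw [hd.deriv, kernel]
  simp [mul_comm]

theorem cderiv_kernel {n : ℕ} (α : Fin n → ℕ) (w : Fin n → ℂ) :
    cderiv α (kernel w) = (∏ j, star (w j) ^ α j) • kernel w := by
  refine cderiv_induction (P := fun a A => A (kernel w) = (∏ j, star (w j) ^ a j) • kernel w)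
    (by simp) (fun a A j h => ?_) α
  funext z
  have : ∏ i, star (w i) ^ ((a + Pi.single j 1 : Fin n → ℕ) i) = (∏ i, star (w i) ^ a i) * star (w j) := by
    simp only [Pi.add_apply, pow_add, Finset.prod_mul_distrib]
    congr 1
    rw [Finset.prod_eq_single j (fun i _ hi => by simp [Pi.single_eq_of_ne hi]) (by simp)]
    simp
  simp only [this, h, partialDeriv_eq_deriv, Pi.smul_apply, smul_eq_mul]
  rw [deriv_const_mul_field, ← partialDeriv_eq_deriv, partialDeriv_kernel, mul_assoc]

/-- The mean value property on `ℂⁿ`, for any finite measure invariant under the scalar rotations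
`u ↦ e^{iθ} u`: average `h` over the orbits, which are circles in complex lines through `0`. -/
theorem integral_eq_of_rotation_invariant {n : ℕ} {ν : Measure (Fin n → ℂ)} [IsFiniteMeasure ν]
    (hν : ∀ θ : ℝ, MeasurePreserving (fun u : Fin n → ℂ => circleMap 0 1 θ • u) ν ν)
    {h : (Fin n → ℂ) → ℂ} (hh : Differentiable ℂ h) (hi : Integrable h ν) :
    ∫ u, h u ∂ν = ν.real Set.univ * h 0 := by
  have hcont : Continuous fun p : ℝ × (Fin n → ℂ) => h (circleMap 0 1 p.1 • p.2) :=
    hh.continuous.comp (((continuous_circleMap 0 1).comp continuous_fst).smul continuous_snd)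
  have hrot : ∀ θ : ℝ, ∫ u, h (circleMap 0 1 θ • u) ∂ν = ∫ u, h u ∂ν := fun θ => by
    have := integral_map (hν θ).measurable.aemeasurable (μ := ν) (f := h)
      hh.continuous.aestronglyMeasurable
    rw [(hν θ).map_eq] at this
    exact this.symm
  have hrotn : ∀ θ : ℝ, ∫ u, ‖h (circleMap 0 1 θ • u)‖ ∂ν = ∫ u, ‖h u‖ ∂ν := fun θ => by
    have := integral_map (hν θ).measurable.aemeasurable (μ := ν) (f := fun u => ‖h u‖)
      hh.continuous.norm.aestronglyMeasurable
    rw [(hν θ).map_eq] at this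
    exact this.symm
  have hint : Integrable (fun p : ℝ × (Fin n → ℂ) => h (circleMap 0 1 p.1 • p.2))
      ((volume.restrict (Set.Ioc 0 (2 * Real.pi))).prod ν) := by
    rw [integrable_prod_iff hcont.aestronglyMeasurable]
    refine ⟨Eventually.of_forall fun θ => (hν θ).integrable_comp_of_integrable hi, ?_⟩
    simp only [hrotn]
    exact integrable_const _
  have hmean : ∀ u, ∫ θ in Set.Ioc 0 (2 * Real.pi), h (circleMap 0 1 θ • u) =
      2 * Real.pi * h 0 := fun u => by
    have hd : Differentiable ℂ fun ζ : ℂ => h (ζ • u) := hh.comp (by fun_prop)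
    have := hd.diffContOnCl.circleAverage (c := 0) (R := 1)
    rw [Real.circleAverage, intervalIntegral.integral_of_le (by positivity), zero_smul] at this
    rw [← this, Complex.real_smul]
    push_cast
    rw [← mul_assoc, mul_inv_cancel₀ (by simp [Real.pi_ne_zero]), one_mul]
  have h2 := integral_integral_swap (μ := volume.restrict (Set.Ioc 0 (2 * Real.pi))) (ν := ν)
    (f := fun θ u => h (circleMap 0 1 θ • u)) hint
  simp only [hmean, hrot, integral_const, Complex.real_smul] at h2
  have h3 : ((volume.restrict (Set.Ioc 0 (2 * Real.pi))).real Set.univ : ℂ) = 2 * Real.pi := by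
    rw [measureReal_def]
    simp [Real.pi_pos.le]
  rw [h3] at h2
  have h4 : (2 * Real.pi : ℂ) ≠ 0 := by simp [Real.pi_ne_zero]
  refine mul_left_cancel₀ h4 (h2.trans ?_)
  ring

/-! ### Injectivity of the Fourier transform on integrable functions -/

theorem ae_eq_zero_of_fourier_real {n : ℕ} {f : (Fin n → ℝ) → ℝ} (hf : Integrable f)
    (h : ∀ ξ : Fin n → ℝ, ∫ x, (f x : ℂ) * Complex.exp (∑ j, ξ j * x j * Complex.I) = 0) :
    f =ᵐ[volume] 0 := by
  have hfin : ∀ g : (Fin n → ℝ) → ℝ, Integrable g →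
      IsFiniteMeasure (volume.withDensity fun x => ENNReal.ofReal (g x)) := fun g hg =>
    isFiniteMeasure_withDensity_ofReal hg.2
  have hn : Integrable fun x => -f x := hf.neg
  have h1 := hfin f hf
  have h2 := hfin _ hn
  have hchar : ∀ g : (Fin n → ℝ) → ℝ, Integrable g → ∀ L : StrongDual ℝ (Fin n → ℝ),
      charFunDual (volume.withDensity fun x => ENNReal.ofReal (g x)) L =
        ∫ x, ((max (g x) 0 : ℝ) : ℂ) * Complex.exp (L x * Complex.I) := fun g hg L => by
    rw [charFunDual_apply, integral_withDensity_eq_integral_toReal_smul₀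
      hg.aestronglyMeasurable.aemeasurable.ennreal_ofReal (by simp)]
    simp [ENNReal.toReal_ofReal']
  have heq : (volume.withDensity fun x => ENNReal.ofReal (f x)) =
      volume.withDensity fun x => ENNReal.ofReal (-f x) := by
    refine Measure.ext_of_charFunDual (funext fun L => ?_)
    rw [hchar f hf, hchar _ hn, ← sub_eq_zero, ← integral_sub]
    · rw [← h fun j => L (Pi.single j 1)]
      refine integral_congr_ae (Eventually.of_forall fun x => ?_)
      have hL : L x = ∑ j, L (Pi.single j 1) * x j := by
        conv_lhs => rw [← Finset.univ_sum_single x, map_sum]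
        refine Finset.sum_congr rfl fun j _ => ?_
        rw [mul_comm, ← smul_eq_mul, ← map_smul, ← Pi.single_smul, smul_eq_mul, mul_one]
      have hmax : max (f x) 0 - max (-f x) 0 = f x := max_zero_sub_eq_self (f x)
      simp only
      rw [← sub_mul, ← Complex.ofReal_sub, hmax, hL, Complex.ofReal_sum, Finset.sum_mul]
      simp
    all_goals
      refine Integrable.mul_bdd (c := 1) ?_ ?_ ?_
      · first | exact hf.pos_part.ofReal | exact hf.neg_part.ofReal
      · exact Continuous.aestronglyMeasurable (by fun_prop)
      · exact Eventually.of_forall fun x => by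
          rw [Complex.norm_exp_ofReal_mul_I]
  rw [withDensity_eq_iff hf.aestronglyMeasurable.aemeasurable.ennreal_ofReal
    hn.aestronglyMeasurable.aemeasurable.ennreal_ofReal
    (by simpa using (withDensity_apply (μ := volume) (fun x => ENNReal.ofReal (f x))
      MeasurableSet.univ).symm.trans_ne (measure_ne_top _ _))] at heq
  filter_upwards [heq] with x hx
  have := congrArg ENNReal.toReal hx
  rw [ENNReal.toReal_ofReal', ENNReal.toReal_ofReal'] at this
  have h3 := max_zero_sub_eq_self (f x)
  simp only [Pi.zero_apply]
  rw [← h3, this]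
  simp

/-- An integrable function on `ℝⁿ` whose Fourier transform vanishes is zero. -/
theorem ae_eq_zero_of_fourier {n : ℕ} {f : (Fin n → ℝ) → ℂ} (hf : Integrable f)
    (h : ∀ ξ : Fin n → ℝ, ∫ x, f x * Complex.exp (∑ j, ξ j * x j * Complex.I) = 0) :
    f =ᵐ[volume] 0 := by
  have hconj : ∀ ξ : Fin n → ℝ,
      ∫ x, star (f x) * Complex.exp (∑ j, ξ j * x j * Complex.I) = 0 := fun ξ => by
    have := congrArg star (h (-ξ))
    rw [star_zero] at this
    rw [← this, ← starRingEnd_apply, ← integral_conj]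
    refine integral_congr_ae (Eventually.of_forall fun x => ?_)
    simp [← Complex.exp_conj]
  have hbdd : ∀ ξ : Fin n → ℝ, ∀ g : (Fin n → ℝ) → ℂ, Integrable g →
      Integrable fun x => g x * Complex.exp (∑ j, ξ j * x j * Complex.I) := fun ξ g hg => by
    refine Integrable.mul_bdd (c := 1) hg (Continuous.aestronglyMeasurable (by fun_prop))
      (Eventually.of_forall fun x => ?_)
    rw [← Finset.sum_mul]
    have : (∑ j, (ξ j : ℂ) * x j) = ((∑ j, ξ j * x j : ℝ) : ℂ) := by push_cast; rfl
    rw [this, Complex.norm_exp_ofReal_mul_I]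
  have hf' : Integrable fun x => star (f x) := by
    simpa using (Complex.conjCLE.toContinuousLinearMap.integrable_comp hf)
  have hre : (fun x => (f x).re) =ᵐ[volume] 0 := by
    refine ae_eq_zero_of_fourier_real hf.re fun ξ => ?_
    have : ∀ x, ((f x).re : ℂ) * Complex.exp (∑ j, ξ j * x j * Complex.I) =
        2⁻¹ * (f x * Complex.exp (∑ j, ξ j * x j * Complex.I) +
          star (f x) * Complex.exp (∑ j, ξ j * x j * Complex.I)) := fun x => by
      have := Complex.re_eq_add_conj (f x)
      rw [this, starRingEnd_apply]
      ring
    simp only [this]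
    rw [integral_const_mul, integral_add (hbdd ξ f hf) (hbdd ξ _ hf'), h, hconj]
    simp
  have him : (fun x => (f x).im) =ᵐ[volume] 0 := by
    refine ae_eq_zero_of_fourier_real hf.im fun ξ => ?_
    have : ∀ x, ((f x).im : ℂ) * Complex.exp (∑ j, ξ j * x j * Complex.I) =
        (2 * Complex.I)⁻¹ * (f x * Complex.exp (∑ j, ξ j * x j * Complex.I) -
          star (f x) * Complex.exp (∑ j, ξ j * x j * Complex.I)) := fun x => by
      have := Complex.im_eq_sub_conj (f x)
      rw [this, starRingEnd_apply]
      ring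
    simp only [this]
    rw [integral_const_mul, integral_sub (hbdd ξ f hf) (hbdd ξ _ hf'), h, hconj]
    simp
  filter_upwards [hre, him] with x h1 h2
  exact Complex.ext h1 h2

/-! ### Coherent states in `L₂(ℝⁿ)` -/

/-- The kernel of the integral operator `B*`, as a function of `x ∈ ℝⁿ` for fixed `a ∈ ℂⁿ`. The
Bargmann transform sends the reproducing kernel `K_w` to `coherent w̄`. -/
def coherent {n : ℕ} (a : Fin n → ℂ) (x : Fin n → ℝ) : ℂ :=
  ((Real.pi ^ (-(n : ℝ) / 4) : ℝ) : ℂ) *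
    Complex.exp (∑ j, ((Real.sqrt 2 : ℂ) * (x j : ℂ) * a j - (x j : ℂ) ^ 2 / 2 - a j ^ 2 / 2))

theorem bargmannStar_eq {n : ℕ} (φ : (Fin n → ℝ) → ℂ) (z : Fin n → ℂ) :
    bargmannStar φ z = ∫ x, φ x * coherent z x := by
  rw [bargmannStar, ← integral_const_mul]
  refine integral_congr_ae (Eventually.of_forall fun x => ?_)
  simp only [coherent]
  ring

theorem continuous_coherent {n : ℕ} :
    Continuous fun p : (Fin n → ℝ) × (Fin n → ℂ) => coherent p.2 p.1 := by
  unfold coherent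
  fun_prop

theorem sqrt_two_sq : (Real.sqrt 2 : ℂ) ^ 2 = 2 := by
  rw [← Complex.ofReal_pow, Real.sq_sqrt (by norm_num)]
  simp

theorem coherent_mul {n : ℕ} (a b : Fin n → ℂ) (x : Fin n → ℝ) :
    coherent a x * coherent b x =
      ((Real.pi ^ (-(n : ℝ) / 2) : ℝ) : ℂ) * Complex.exp (-∑ j, (a j ^ 2 + b j ^ 2) / 2) *
        Complex.exp (-1 * ∑ j, (x j : ℂ) ^ 2 + ∑ j, (Real.sqrt 2 * (a j + b j)) * x j) := by
  have h1 : ((Real.pi ^ (-(n : ℝ) / 2) : ℝ) : ℂ) =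
      ((Real.pi ^ (-(n : ℝ) / 4) : ℝ) : ℂ) * ((Real.pi ^ (-(n : ℝ) / 4) : ℝ) : ℂ) := by
    rw [← Complex.ofReal_mul, ← Real.rpow_add Real.pi_pos]
    congr 2; ring
  rw [coherent, coherent, h1, mul_mul_mul_comm, ← Complex.exp_add, mul_assoc (_ * _),
    ← Complex.exp_add]
  congr 2
  rw [Finset.mul_sum, ← Finset.sum_add_distrib, ← Finset.sum_neg_distrib, ← Finset.sum_add_distrib,
    ← Finset.sum_add_distrib]
  refine Finset.sum_congr rfl fun j _ => ?_
  ring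

theorem integrable_coherent_mul {n : ℕ} (a b : Fin n → ℂ) :
    Integrable fun x => coherent a x * coherent b x := by
  simp only [coherent_mul]
  exact (GaussianFourier.integrable_cexp_neg_mul_sum_add (by simp) _).const_mul _

theorem integral_coherent_mul {n : ℕ} (a b : Fin n → ℂ) :
    ∫ x, coherent a x * coherent b x = Complex.exp (∑ j, a j * b j) := by
  simp only [coherent_mul]
  rw [integral_const_mul, GaussianFourier.integral_cexp_neg_mul_sum_add (by simp), Fintype.card_fin]
  have h1 : ((Real.pi ^ (-(n : ℝ) / 2) : ℝ) : ℂ) * ((Real.pi : ℂ) / 1) ^ ((n : ℂ) / 2) = 1 := by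
    rw [div_one, Complex.ofReal_cpow Real.pi_pos.le,
      ← Complex.cpow_add _ _ (by simp [Real.pi_ne_zero])]
    have : (((-(n : ℝ) / 2 : ℝ)) : ℂ) + (n : ℂ) / 2 = 0 := by push_cast; ring
    rw [this, Complex.cpow_zero]
  rw [mul_mul_mul_comm, h1, one_mul, ← Complex.exp_add]
  congr 1
  rw [mul_one, Finset.sum_div, ← Finset.sum_neg_distrib, ← Finset.sum_add_distrib]
  refine Finset.sum_congr rfl fun j _ => ?_
  rw [mul_pow, sqrt_two_sq]
  ring

theorem star_coherent {n : ℕ} (a : Fin n → ℂ) (x : Fin n → ℝ) :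
    star (coherent a x) = coherent (star a) x := by
  simp [coherent, ← Complex.exp_conj, map_ofNat]

theorem memLp_coherent {n : ℕ} (a : Fin n → ℂ) : MemLp (coherent a) 2 volume := by
  have hc : Continuous (coherent a) := by unfold coherent; fun_prop
  rw [memLp_two_iff_integrable_sq_norm hc.aestronglyMeasurable]
  refine (integrable_coherent_mul a a).norm.congr (Eventually.of_forall fun x => ?_)
  simp [sq]

/-- The coherent state as an element of `L₂(ℝⁿ)`. -/
def coherentLp {n : ℕ} (a : Fin n → ℂ) : Lp ℂ 2 (volume : Measure (Fin n → ℝ)) :=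
  (memLp_coherent a).toLp

theorem coherentLp_coe {n : ℕ} (a : Fin n → ℂ) : coherentLp a =ᵐ[volume] coherent a :=
  (memLp_coherent a).coeFn_toLp

theorem bargmannStar_eq_inner {n : ℕ} (φ : Lp ℂ 2 (volume : Measure (Fin n → ℝ)))
    (z : Fin n → ℂ) : bargmannStar φ z = inner ℂ (coherentLp (star z)) φ := by
  rw [bargmannStar_eq, L2.inner_def]
  refine integral_congr_ae ?_
  filter_upwards [coherentLp_coe (star z)] with x hx
  rw [hx, RCLike.inner_apply, starRingEnd_apply, star_coherent, star_star]

/-- A function on `ℝⁿ` that is orthogonal to all coherent states vanishes: its pairings with the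
coherent states contain the Fourier transform of its product with a Gaussian. -/
theorem ae_eq_zero_of_coherent {n : ℕ} {g : (Fin n → ℝ) → ℂ}
    (hg : Integrable fun x => g x * coherent 0 x)
    (h : ∀ b, ∫ x, g x * coherent b x = 0) : g =ᵐ[volume] 0 := by
  have hz := ae_eq_zero_of_fourier hg fun ξ => by
    have hx : ∀ x, g x * coherent (fun j => Complex.I * ξ j / Real.sqrt 2) x =
        Complex.exp (∑ j, (ξ j : ℂ) ^ 2 / 4) *
          (g x * coherent 0 x * Complex.exp (∑ j, ξ j * x j * Complex.I)) := fun x => by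
      have h2 : Complex.exp (∑ j, ((Real.sqrt 2 : ℂ) * (x j : ℂ) * (Complex.I * ξ j / Real.sqrt 2) -
            (x j : ℂ) ^ 2 / 2 - (Complex.I * ξ j / Real.sqrt 2) ^ 2 / 2)) =
          Complex.exp (∑ j, (ξ j : ℂ) ^ 2 / 4) * (Complex.exp (∑ j, ((Real.sqrt 2 : ℂ) *
            (x j : ℂ) * (0 : Fin n → ℂ) j - (x j : ℂ) ^ 2 / 2 - (0 : Fin n → ℂ) j ^ 2 / 2)) *
          Complex.exp (∑ j, ξ j * x j * Complex.I)) := by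
        rw [← Complex.exp_add, ← Complex.exp_add, ← Finset.sum_add_distrib,
          ← Finset.sum_add_distrib]
        congr 1
        refine Finset.sum_congr rfl fun j _ => ?_
        have h0 : (Real.sqrt 2 : ℂ) ≠ 0 := by simp
        rw [div_pow, sqrt_two_sq, mul_pow, Complex.I_sq, mul_div_assoc', mul_assoc,
          mul_div_cancel_left₀ _ h0]
        simp only [Pi.zero_apply]
        ring
      rw [coherent, coherent, h2]
      ring
    have := h fun j => Complex.I * ξ j / Real.sqrt 2
    simp only [hx, integral_const_mul] at this
    exact (mul_eq_zero.1 this).resolve_left (Complex.exp_ne_zero _)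
  filter_upwards [hz] with x hx
  refine (mul_eq_zero.1 hx).resolve_right ?_
  have := Real.rpow_pos_of_pos Real.pi_pos (-(n : ℝ) / 4)
  simp [coherent, Complex.exp_ne_zero, this.ne']

/-- Coherent states span a dense subspace of `L₂(ℝⁿ)`. -/
theorem dense_span_coherentLp {n : ℕ} :
    (Submodule.span ℂ (Set.range (coherentLp (n := n)))).topologicalClosure = ⊤ := by
  rw [Submodule.topologicalClosure_eq_top_iff, Submodule.eq_bot_iff]
  intro φ hφ
  have h : ∀ b, ∫ x, φ x * coherent b x = 0 := fun b => by
    rw [← bargmannStar_eq, bargmannStar_eq_inner]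
    exact (Submodule.mem_orthogonal _ _).1 hφ _ (Submodule.subset_span ⟨_, rfl⟩)
  have hi : Integrable fun x => φ x * coherent 0 x :=
    (Lp.memLp φ).integrable_mul (memLp_coherent 0)
  exact (Lp.eq_zero_iff_ae_eq_zero).2 (ae_eq_zero_of_coherent hi h)

theorem bargmannStar_coherentLp {n : ℕ} (a z : Fin n → ℂ) :
    bargmannStar (coherentLp (star a)) z = kernel a z := by
  rw [bargmannStar_eq, kernel, show (∑ j, star (a j) * z j) = ∑ j, (star a) j * z j from rfl,
    ← integral_coherent_mul]
  refine integral_congr_ae ?_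
  filter_upwards [coherentLp_coe (star a)] with x hx
  rw [hx]

theorem norm_coherent_le {n : ℕ} (R : ℝ) (z : Fin n → ℂ) (hz : ‖z‖ ≤ R) (x : Fin n → ℝ) :
    ‖coherent z x‖ ≤ Real.pi ^ (-(n : ℝ) / 4) *
      (Real.exp (n * (5 / 2 * R ^ 2)) * Real.exp (-(1 / 4) * ∑ j, x j ^ 2)) := by
  have hpi := (Real.rpow_pos_of_pos Real.pi_pos (-(n : ℝ) / 4)).le
  rw [coherent, norm_mul, Complex.norm_real, Real.norm_of_nonneg hpi, Complex.norm_exp]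
  refine mul_le_mul_of_nonneg_left ?_ hpi
  rw [← Real.exp_add, Real.exp_le_exp, Complex.re_sum]
  have : n * (5 / 2 * R ^ 2) + -(1 / 4) * ∑ j, x j ^ 2 =
      ∑ j : Fin n, (5 / 2 * R ^ 2 + -(1 / 4) * x j ^ 2) := by
    simp [Finset.sum_add_distrib, Finset.mul_sum]
  rw [this]
  refine Finset.sum_le_sum fun j _ => ?_
  have h1 : ‖z j‖ ^ 2 ≤ R ^ 2 := by
    gcongr
    exact (norm_le_pi_norm z j).trans hz
  rw [Complex.sq_norm, Complex.normSq_apply] at h1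
  have h2 : ((Real.sqrt 2 : ℂ) * (x j : ℂ) * z j - (x j : ℂ) ^ 2 / 2 - z j ^ 2 / 2).re =
      Real.sqrt 2 * x j * (z j).re - x j ^ 2 / 2 - ((z j).re ^ 2 - (z j).im ^ 2) / 2 := by
    rw [← Complex.ofReal_mul, ← Complex.ofReal_pow, Complex.sub_re, Complex.sub_re,
      Complex.re_ofReal_mul]
    simp [sq]
  rw [h2]
  have h3 : Real.sqrt 2 ^ 2 = 2 := Real.sq_sqrt (by norm_num)
  nlinarith [sq_nonneg (x j / 2 - Real.sqrt 2 * (z j).re), sq_nonneg (z j).im,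
    sq_nonneg (z j).re]

theorem integrable_exp_neg_mul_sum_add {n : ℕ} {b : ℝ} (hb : 0 < b) (c : Fin n → ℝ) :
    Integrable fun x : Fin n → ℝ => Real.exp (-b * ∑ j, x j ^ 2 + ∑ j, c j * x j) := by
  refine (GaussianFourier.integrable_cexp_neg_mul_sum_add (b := b) (by simpa)
    (fun j => (c j : ℂ))).norm.congr (Eventually.of_forall fun x => ?_)
  have : (-(b : ℂ) * ∑ j, (x j : ℂ) ^ 2 + ∑ j, (c j : ℂ) * x j) =
      ((-b * ∑ j, x j ^ 2 + ∑ j, c j * x j : ℝ) : ℂ) := by push_cast; rfl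
  simp only
  rw [this, Complex.norm_exp_ofReal]

/-- `B* φ` is entire for `φ ∈ L₂(ℝⁿ)`. -/
theorem differentiable_bargmannStar {n : ℕ} (φ : Lp ℂ 2 (volume : Measure (Fin n → ℝ))) :
    Differentiable ℂ (bargmannStar (n := n) φ) := by
  have : bargmannStar (n := n) φ = fun z => ∫ x, φ x * coherent z x :=
    funext fun z => bargmannStar_eq _ z
  rw [this]
  refine differentiable_integral_mul (k := fun x z => coherent z x)
    (Lp.memLp φ).aestronglyMeasurable continuous_coherent (fun x => ?_) fun z₀ => ?_
  · unfold coherent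
    fun_prop
  · have hm : MemLp (fun x : Fin n → ℝ => Real.exp (-(1 / 4) * ∑ j, x j ^ 2)) 2 volume := by
      rw [memLp_two_iff_integrable_sq (Continuous.aestronglyMeasurable (by fun_prop))]
      refine (integrable_exp_neg_mul_sum_add (b := 1 / 2) (by norm_num) 0).congr
        (Eventually.of_forall fun x => ?_)
      simp only [Pi.zero_apply, zero_mul, Finset.sum_const_zero, add_zero, ← Real.exp_nat_mul]
      congr 1
      push_cast
      ring
    refine ⟨fun x => ‖φ x‖ * (Real.pi ^ (-(n : ℝ) / 4) *
      (Real.exp (n * (5 / 2 * (‖z₀‖ + 2) ^ 2)) * Real.exp (-(1 / 4) * ∑ j, x j ^ 2))), ?_, ?_⟩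
    · exact (Lp.memLp φ).norm.integrable_mul ((hm.const_mul _).const_mul _)
    · intro z hz x
      rw [norm_mul]
      refine mul_le_mul_of_nonneg_left (norm_coherent_le _ z ?_ x) (norm_nonneg _)
      have := mem_ball_iff_norm.1 hz
      linarith [norm_le_norm_add_norm_sub' z z₀]

/-! ### The Fock space and its reproducing kernel -/

theorem sqNorm_eq {n : ℕ} (z : Fin n → ℂ) : (sqNorm z : ℂ) = ∑ j, star (z j) * z j := by
  simp only [sqNorm, Complex.ofReal_sum]
  refine Finset.sum_congr rfl fun j _ => ?_
  rw [← starRingEnd_apply, Complex.conj_mul']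
  push_cast
  rfl

theorem continuous_sqNorm {n : ℕ} : Continuous (sqNorm (n := n)) := by
  unfold sqNorm
  fun_prop

theorem sqNorm_add {n : ℕ} (z u : Fin n → ℂ) :
    sqNorm (z + u) = sqNorm z + 2 * (∑ j, star (z j) * u j).re + sqNorm u := by
  rw [sqNorm, sqNorm, sqNorm, Complex.re_sum, Finset.mul_sum, ← Finset.sum_add_distrib,
    ← Finset.sum_add_distrib]
  refine Finset.sum_congr rfl fun j _ => ?_
  simp only [Complex.sq_norm, Complex.normSq_apply, Pi.add_apply, Complex.add_re, Complex.add_im,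
    Complex.mul_re, ← starRingEnd_apply, Complex.conj_re, Complex.conj_im]
  ring

theorem norm_kernel {n : ℕ} (z u : Fin n → ℂ) :
    ‖kernel z u‖ = Real.exp (∑ j, star (z j) * u j).re := by
  rw [kernel, Complex.norm_exp]

theorem norm_kernel_mul_exp {n : ℕ} (z u : Fin n → ℂ) :
    ‖kernel z u‖ ^ 2 * Real.exp (-sqNorm u) = Real.exp (sqNorm z) * Real.exp (-sqNorm (u - z)) := by
  have : sqNorm (u - z) = sqNorm u - 2 * (∑ j, star (z j) * u j).re + sqNorm z := by
    have h := sqNorm_add (-z) u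
    have h1 : sqNorm (-z) = sqNorm z := by simp [sqNorm]
    have h2 : (∑ j, star ((-z) j) * u j).re = -(∑ j, star (z j) * u j).re := by simp
    rw [h1, h2, neg_add_eq_sub] at h
    linarith
  rw [norm_kernel, ← Real.exp_nat_mul, ← Real.exp_add, ← Real.exp_add, this]
  congr 1
  push_cast
  ring

theorem integrable_exp_neg_sqNorm {n : ℕ} :
    Integrable fun z : Fin n → ℂ => Real.exp (-sqNorm z) := by
  have h1 : Integrable fun z : ℂ => Real.exp (-‖z‖ ^ 2) := by
    refine (GaussianFourier.integrable_cexp_neg_mul_sq_norm_add (V := ℂ) (b := 1) (by simp) 0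
      0).norm.congr (Eventually.of_forall fun z => ?_)
    simp only [Complex.norm_exp]
    congr 1
    simp [← Complex.ofReal_pow]
  refine (Integrable.fintype_prod (f := fun _ z => Real.exp (-‖z‖ ^ 2))
    fun _ : Fin n => h1).congr (Eventually.of_forall fun z => ?_)
  simp only [sqNorm, ← Real.exp_sum, Finset.sum_neg_distrib]

theorem integral_exp_neg_sqNorm {n : ℕ} :
    ∫ z : Fin n → ℂ, Real.exp (-sqNorm z) = Real.pi ^ n := by
  have h1 : ∫ z : ℂ, Real.exp (-‖z‖ ^ 2) = Real.pi := by
    have := GaussianFourier.integral_rexp_neg_mul_sq_norm (V := ℂ) (b := 1) one_pos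
    simpa [Complex.finrank_real_complex] using this
  have h2 := integral_fintype_prod_volume_eq_pow (ι := Fin n) fun z : ℂ => Real.exp (-‖z‖ ^ 2)
  rw [h1, Fintype.card_fin] at h2
  rw [← h2]
  simp only [sqNorm, ← Real.exp_sum, Finset.sum_neg_distrib]

theorem measurable_gauss_density {n : ℕ} : Measurable fun z : Fin n → ℂ =>
    ENNReal.ofReal ((Real.pi ^ n)⁻¹ * Real.exp (-sqNorm z)) := by
  have := (continuous_sqNorm (n := n)).measurable
  fun_prop

theorem gauss_density_pos {n : ℕ} (z : Fin n → ℂ) : 0 < (Real.pi ^ n)⁻¹ * Real.exp (-sqNorm z) := by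
  have := Real.pi_pos
  positivity

instance {n : ℕ} : IsProbabilityMeasure (gauss n) := by
  refine ⟨?_⟩
  rw [gauss, withDensity_apply _ MeasurableSet.univ, Measure.restrict_univ,
    ← ofReal_integral_eq_lintegral_ofReal (integrable_exp_neg_sqNorm.const_mul _)
      (Eventually.of_forall fun z => (gauss_density_pos z).le), integral_const_mul,
    integral_exp_neg_sqNorm, inv_mul_cancel₀ (pow_ne_zero _ Real.pi_ne_zero), ENNReal.ofReal_one]

instance {n : ℕ} : (gauss n).IsOpenPosMeasure := by
  refine (withDensity_absolutelyContinuous' measurable_gauss_density.aemeasurable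
    (Eventually.of_forall fun z => ?_) : volume ≪ gauss n).isOpenPosMeasure
  simpa using gauss_density_pos z

theorem integral_gauss {n : ℕ} (f : (Fin n → ℂ) → ℂ) :
    ∫ z, f z ∂gauss n =
      ∫ z, ((((Real.pi ^ n)⁻¹ * Real.exp (-sqNorm z) : ℝ)) : ℂ) * f z := by
  rw [gauss, integral_withDensity_eq_integral_toReal_smul measurable_gauss_density (by simp)]
  simp only [ENNReal.toReal_ofReal (gauss_density_pos _).le, Complex.real_smul]

theorem integrable_gauss_iff {n : ℕ} (f : (Fin n → ℂ) → ℂ) :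
    Integrable f (gauss n) ↔
      Integrable fun z => ((((Real.pi ^ n)⁻¹ * Real.exp (-sqNorm z) : ℝ)) : ℂ) * f z := by
  rw [gauss, integrable_withDensity_iff_integrable_smul' measurable_gauss_density (by simp)]
  simp only [ENNReal.toReal_ofReal (gauss_density_pos _).le, Complex.real_smul]

theorem measurePreserving_rotation {n : ℕ} (θ : ℝ) :
    MeasurePreserving fun u : Fin n → ℂ => circleMap 0 1 θ • u := by
  have h : MeasurePreserving fun u : ℂ => circleMap 0 1 θ * u := by
    have h1 : (circleMap 0 1 θ : ℂ) = (Circle.exp θ : ℂ) := by simp [circleMap]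
    rw [h1]
    exact (rotation (Circle.exp θ)).measurePreserving
  exact volume_preserving_pi fun _ => h

/-- A measure whose density with respect to Lebesgue measure is invariant under scalar rotations is
itself invariant. -/
theorem measurePreserving_rotation_withDensity {n : ℕ} {ρ : (Fin n → ℂ) → ENNReal}
    (hρ : Measurable ρ) (hinv : ∀ (θ : ℝ) u, ρ (circleMap 0 1 θ • u) = ρ u) (θ : ℝ) :
    MeasurePreserving (fun u : Fin n → ℂ => circleMap 0 1 θ • u) (volume.withDensity ρ)
      (volume.withDensity ρ) := by
  have hr := measurePreserving_rotation (n := n) θ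
  refine ⟨hr.measurable, Measure.ext fun s hs => ?_⟩
  rw [Measure.map_apply hr.measurable hs, withDensity_apply _ (hr.measurable hs),
    withDensity_apply _ hs, ← hr.setLIntegral_comp_preimage hs hρ]
  simp only [hinv]

theorem measurePreserving_rotation_gauss {n : ℕ} (θ : ℝ) :
    MeasurePreserving (fun u : Fin n → ℂ => circleMap 0 1 θ • u) (gauss n) (gauss n) :=
  measurePreserving_rotation_withDensity measurable_gauss_density
    (fun θ u => by simp [sqNorm]) θ

theorem differentiable_entire {n : ℕ} (f : Fock n) : Differentiable ℂ (entire f) :=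
  (Classical.choose_spec f.2).1

theorem coe_ae_eq_entire {n : ℕ} (f : Fock n) : (f : Lp ℂ 2 (gauss n)) =ᵐ[gauss n] entire f :=
  (Classical.choose_spec f.2).2

theorem entire_eq_of_ae {n : ℕ} {f : Fock n} {F : (Fin n → ℂ) → ℂ} (hF : Differentiable ℂ F)
    (h : (f : Lp ℂ 2 (gauss n)) =ᵐ[gauss n] F) : entire f = F :=
  ((differentiable_entire f).continuous.ae_eq_iff_eq (gauss n) hF.continuous).1
    ((coe_ae_eq_entire f).symm.trans h)

theorem memLp_entire {n : ℕ} (f : Fock n) : MemLp (entire f) 2 (gauss n) :=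
  (Lp.memLp (f : Lp ℂ 2 (gauss n))).ae_eq (coe_ae_eq_entire f)

theorem entire_add {n : ℕ} (f g : Fock n) : entire (f + g) = entire f + entire g := by
  refine entire_eq_of_ae ((differentiable_entire f).add (differentiable_entire g)) ?_
  exact (Lp.coeFn_add (f : Lp ℂ 2 (gauss n)) g).trans
    ((coe_ae_eq_entire f).add (coe_ae_eq_entire g))

theorem entire_smul {n : ℕ} (c : ℂ) (f : Fock n) : entire (c • f) = c • entire f := by
  refine entire_eq_of_ae ((differentiable_entire f).const_smul c) ?_
  refine (Lp.coeFn_smul c (f : Lp ℂ 2 (gauss n))).trans ?_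
  filter_upwards [coe_ae_eq_entire f] with z hz
  simp [hz]

theorem memLp_kernel {n : ℕ} (w : Fin n → ℂ) : MemLp (kernel w) 2 (gauss n) := by
  have hc := (differentiable_kernel w).continuous
  rw [memLp_two_iff_integrable_sq_norm hc.aestronglyMeasurable]
  have h : Integrable (fun z => ((‖kernel w z‖ ^ 2 : ℝ) : ℂ)) (gauss n) := by
    rw [integrable_gauss_iff]
    refine ((((integrable_exp_neg_sqNorm.comp_sub_right w).const_mul
      (Real.exp (sqNorm w))).const_mul (Real.pi ^ n)⁻¹).ofReal (𝕜 := ℂ)).congr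
      (Eventually.of_forall fun z => ?_)
    simp only
    rw [← norm_kernel_mul_exp]
    simp only [RCLike.ofReal_mul, Complex.coe_algebraMap, Complex.ofReal_mul]
    push_cast
    ring
  exact h.re

/-- The reproducing kernel as an element of the Fock space. -/
def kernelFock {n : ℕ} (w : Fin n → ℂ) : Fock n :=
  ⟨(memLp_kernel w).toLp, kernel w, differentiable_kernel w, (memLp_kernel w).coeFn_toLp⟩

theorem entire_kernelFock {n : ℕ} (w : Fin n → ℂ) : entire (kernelFock w) = kernel w :=
  entire_eq_of_ae (differentiable_kernel w) (memLp_kernel w).coeFn_toLp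

theorem inner_eq_integral_entire {n : ℕ} (f g : Fock n) :
    inner ℂ g f = ∫ u, entire f u * star (entire g u) ∂gauss n := by
  rw [Submodule.coe_inner, L2.inner_def]
  refine integral_congr_ae ?_
  filter_upwards [coe_ae_eq_entire f, coe_ae_eq_entire g] with u h1 h2
  rw [h1, h2, RCLike.inner_apply, starRingEnd_apply]

/-- The reproducing property. After translation by `z` it is the mean value property of the entire
function `u ↦ f (z + u) e^{-z̄ · u}` for the Gaussian measure. -/
theorem inner_kernelFock {n : ℕ} (z : Fin n → ℂ) (f : Fock n) :
    inner ℂ (kernelFock z) f = entire f z := by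
  set h : (Fin n → ℂ) → ℂ := fun u => entire f (u + z) * kernel (-z) u
  have hd : Differentiable ℂ h :=
    ((differentiable_entire f).comp (by fun_prop)).mul (differentiable_kernel _)
  set G : (Fin n → ℂ) → ℂ := fun u => ((((Real.pi ^ n)⁻¹ * Real.exp (-sqNorm u) : ℝ)) : ℂ) *
    (entire f u * star (kernel z u))
  have hG : ∀ u, G (u + z) = ((((Real.pi ^ n)⁻¹ * Real.exp (-sqNorm u) : ℝ)) : ℂ) * h u := by
    intro u
    have hexp : (Real.exp (-sqNorm (u + z)) : ℂ) * star (kernel z (u + z)) =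
        Real.exp (-sqNorm u) * kernel (-z) u := by
      rw [kernel, kernel, ← starRingEnd_apply, ← Complex.exp_conj, Complex.ofReal_exp,
        Complex.ofReal_exp, ← Complex.exp_add, ← Complex.exp_add, Complex.ofReal_neg,
        Complex.ofReal_neg, sqNorm_eq, sqNorm_eq, map_sum, ← Finset.sum_neg_distrib,
        ← Finset.sum_neg_distrib, ← Finset.sum_add_distrib, ← Finset.sum_add_distrib]
      congr 1
      refine Finset.sum_congr rfl fun j _ => ?_
      simp
      ring
    simp only [G, h]
    push_cast at hexp ⊢
    linear_combination (Real.pi ^ n : ℂ)⁻¹ * entire f (u + z) * hexp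
  have hGi : Integrable G := by
    rw [← integrable_gauss_iff]
    exact (memLp_entire f).integrable_mul (memLp_kernel z).star
  have hhi : Integrable h (gauss n) := by
    rw [integrable_gauss_iff]
    simp only [← hG]
    exact hGi.comp_add_right z
  rw [inner_eq_integral_entire, entire_kernelFock, integral_gauss,
    ← integral_add_right_eq_self G z]
  simp only [hG]
  rw [← integral_gauss, integral_eq_of_rotation_invariant measurePreserving_rotation_gauss hd hhi]
  simp [h, kernel]

/-! ### The Bargmann transform -/

theorem entire_injective {n : ℕ} {f g : Fock n} (h : entire f = entire g) : f = g := by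
  refine Subtype.ext (Lp.ext ?_)
  exact (coe_ae_eq_entire f).trans (h ▸ (coe_ae_eq_entire g).symm)

/-- The span of the pairs formed by a coherent state and the reproducing kernel it represents: the
graph of the Bargmann transform over the span of the coherent states. -/
def bargmannGraph (n : ℕ) : Submodule ℂ (Lp ℂ 2 (volume : Measure (Fin n → ℝ)) × Fock n) :=
  Submodule.span ℂ (Set.range fun w => (coherentLp (star w), kernelFock w))

/-- Both Gram matrices have the entries `K_v(w)`. -/
theorem inner_bargmannGraph {n : ℕ} {p q : Lp ℂ 2 (volume : Measure (Fin n → ℝ)) × Fock n}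
    (hp : p ∈ bargmannGraph n) (hq : q ∈ bargmannGraph n) :
    inner ℂ p.2 q.2 = inner ℂ p.1 q.1 := by
  refine Submodule.span_induction ?_ ?_ ?_ ?_ hp
  · rintro _ ⟨w, rfl⟩
    refine Submodule.span_induction ?_ ?_ ?_ ?_ hq
    · rintro _ ⟨v, rfl⟩
      rw [inner_kernelFock, entire_kernelFock, ← bargmannStar_eq_inner, bargmannStar_coherentLp]
    · simp
    · intro x y _ _ hx hy
      rw [Prod.fst_add, Prod.snd_add, inner_add_right, inner_add_right, hx, hy]
    · intro c x _ hx
      rw [Prod.smul_fst, Prod.smul_snd, inner_smul_right, inner_smul_right, hx]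
  · simp
  · intro x y _ _ hx hy
    rw [Prod.fst_add, Prod.snd_add, inner_add_left, inner_add_left, hx, hy]
  · intro c x _ hx
    rw [Prod.smul_fst, Prod.smul_snd, inner_smul_left, inner_smul_left, hx]

theorem entire_bargmannGraph {n : ℕ} {p : Lp ℂ 2 (volume : Measure (Fin n → ℝ)) × Fock n}
    (hp : p ∈ bargmannGraph n) : entire p.2 = bargmannStar (n := n) p.1 := by
  funext z
  rw [← inner_kernelFock, bargmannStar_eq_inner]
  exact inner_bargmannGraph (p := (coherentLp (star z), kernelFock z))
    (Submodule.subset_span ⟨z, rfl⟩) hp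

theorem norm_bargmannGraph {n : ℕ} {p : Lp ℂ 2 (volume : Measure (Fin n → ℝ)) × Fock n}
    (hp : p ∈ bargmannGraph n) : ‖p.2‖ = ‖p.1‖ := by
  rw [@norm_eq_sqrt_re_inner ℂ, @norm_eq_sqrt_re_inner ℂ, inner_bargmannGraph hp hp]

theorem dense_fst_bargmannGraph {n : ℕ} :
    Dense ((fun p : Lp ℂ 2 (volume : Measure (Fin n → ℝ)) × Fock n => p.1) ''
      (bargmannGraph n : Set _)) := by
  have h1 : (bargmannGraph n).map (LinearMap.fst ℂ _ _) =
      Submodule.span ℂ (Set.range (coherentLp (n := n))) := by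
    rw [bargmannGraph, Submodule.map_span, ← Set.range_comp]
    congr 1
    exact (star_involutive.surjective.range_comp (coherentLp (n := n)))
  have h2 := Submodule.dense_iff_topologicalClosure_eq_top.2 (dense_span_coherentLp (n := n))
  rw [← h1] at h2
  exact h2

/-- `B* φ` lies in `L₂(gₙ)`, with norm at most `‖φ‖`: this holds on the dense span of the coherent
states, and passes to limits by Fatou's lemma. -/
theorem eLpNorm_bargmannStar_le {n : ℕ} (φ : Lp ℂ 2 (volume : Measure (Fin n → ℝ))) :
    eLpNorm (bargmannStar (n := n) φ) 2 (gauss n) ≤ ENNReal.ofReal ‖φ‖ := by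
  obtain ⟨s, hs, hlim⟩ := mem_closure_iff_seq_limit.1 (dense_fst_bargmannGraph φ)
  choose p hp hps using hs
  have hps' : ∀ i, (p i).1 = s i := hps
  have hpt : ∀ z, Tendsto (fun i => bargmannStar (n := n) (s i) z) atTop
      (𝓝 (bargmannStar (n := n) φ z)) := fun z => by
    simp only [bargmannStar_eq_inner]
    exact tendsto_const_nhds.inner hlim
  refine (Lp.eLpNorm_lim_le_liminf_eLpNorm
    (fun i => (differentiable_bargmannStar (s i)).continuous.aestronglyMeasurable) _
    (Eventually.of_forall hpt)).trans ?_
  have hn : ∀ i, eLpNorm (bargmannStar (n := n) (s i)) 2 (gauss n) = ENNReal.ofReal ‖s i‖ :=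
    fun i => by
      rw [← hps' i, ← entire_bargmannGraph (hp i), ← norm_bargmannGraph (hp i),
        ← eLpNorm_congr_ae (coe_ae_eq_entire _), Submodule.coe_norm, Lp.norm_def,
        ENNReal.ofReal_toReal (Lp.eLpNorm_ne_top _)]
  simp only [hn]
  exact ((ENNReal.continuous_ofReal.tendsto _).comp hlim.norm).liminf_eq.le

theorem memLp_bargmannStar {n : ℕ} (φ : Lp ℂ 2 (volume : Measure (Fin n → ℝ))) :
    MemLp (bargmannStar (n := n) φ) 2 (gauss n) :=
  ⟨(differentiable_bargmannStar φ).continuous.aestronglyMeasurable,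
    (eLpNorm_bargmannStar_le φ).trans_lt ENNReal.ofReal_lt_top⟩

/-- The operator `B*` from `L₂(ℝⁿ)` to the Fock space. -/
def bargmannFun {n : ℕ} (φ : Lp ℂ 2 (volume : Measure (Fin n → ℝ))) : Fock n :=
  ⟨(memLp_bargmannStar φ).toLp, bargmannStar φ, differentiable_bargmannStar φ,
    (memLp_bargmannStar φ).coeFn_toLp⟩

theorem entire_bargmannFun {n : ℕ} (φ : Lp ℂ 2 (volume : Measure (Fin n → ℝ))) :
    entire (bargmannFun φ) = bargmannStar (n := n) φ :=
  entire_eq_of_ae (differentiable_bargmannStar φ) (memLp_bargmannStar φ).coeFn_toLp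

theorem bargmannFun_of_mem {n : ℕ} {p : Lp ℂ 2 (volume : Measure (Fin n → ℝ)) × Fock n}
    (hp : p ∈ bargmannGraph n) : bargmannFun p.1 = p.2 :=
  entire_injective ((entire_bargmannFun _).trans (entire_bargmannGraph hp).symm)

/-- `B*` as a bounded linear operator. -/
def bargmannCLM (n : ℕ) : Lp ℂ 2 (volume : Measure (Fin n → ℝ)) →L[ℂ] Fock n :=
  LinearMap.mkContinuous
    { toFun := bargmannFun
      map_add' := fun φ ψ => entire_injective <| by
        rw [entire_add, entire_bargmannFun, entire_bargmannFun, entire_bargmannFun]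
        funext z
        simp only [Pi.add_apply, bargmannStar_eq_inner, inner_add_right]
      map_smul' := fun c φ => entire_injective <| by
        rw [RingHom.id_apply, entire_smul, entire_bargmannFun, entire_bargmannFun]
        funext z
        simp only [Pi.smul_apply, bargmannStar_eq_inner, inner_smul_right, smul_eq_mul] }
    1 fun φ => by
      rw [one_mul]
      change ‖(memLp_bargmannStar φ).toLp‖ ≤ ‖φ‖
      rw [Lp.norm_toLp]
      exact ENNReal.toReal_le_of_le_ofReal (norm_nonneg _) (eLpNorm_bargmannStar_le φ)

theorem norm_bargmannCLM {n : ℕ} (φ : Lp ℂ 2 (volume : Measure (Fin n → ℝ))) :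
    ‖bargmannCLM n φ‖ = ‖φ‖ := by
  have hcl : IsClosed {φ | ‖bargmannCLM n φ‖ = ‖φ‖} :=
    isClosed_eq (bargmannCLM n).continuous.norm continuous_norm
  refine (hcl.closure_subset_iff.2 ?_) (dense_fst_bargmannGraph φ)
  rintro _ ⟨p, hp, rfl⟩
  change ‖bargmannFun p.1‖ = ‖p.1‖
  rw [bargmannFun_of_mem hp, norm_bargmannGraph hp]

theorem bargmannCLM_coherentLp {n : ℕ} (w : Fin n → ℂ) :
    bargmannCLM n (coherentLp (star w)) = kernelFock w :=
  bargmannFun_of_mem (p := (coherentLp (star w), kernelFock w)) (Submodule.subset_span ⟨w, rfl⟩)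

/-- The range of `B*` is complete and contains every reproducing kernel, hence is the whole Fock
space. -/
theorem surjective_bargmannCLM (n : ℕ) : Function.Surjective (bargmannCLM n) := by
  set U : Lp ℂ 2 (volume : Measure (Fin n → ℝ)) →ₗᵢ[ℂ] Fock n :=
    ⟨(bargmannCLM n).toLinearMap, norm_bargmannCLM⟩
  have hc : CompleteSpace (LinearMap.range U.toLinearMap) := by
    refine IsComplete.completeSpace_coe ?_
    rw [LinearMap.coe_range]
    exact U.isometry.isUniformInducing.isComplete_range
  have htop : LinearMap.range U.toLinearMap = ⊤ := by
    rw [← Submodule.orthogonal_eq_bot_iff, Submodule.eq_bot_iff]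
    intro f hf
    refine entire_injective (funext fun z => ?_)
    rw [← inner_kernelFock, ← inner_kernelFock, inner_zero_right]
    exact (Submodule.mem_orthogonal _ _).1 hf _ ⟨_, bargmannCLM_coherentLp z⟩
  exact LinearMap.range_eq_top.1 htop

/-- The Bargmann transform. -/
def bargmann (n : ℕ) : Fock n ≃ₗᵢ[ℂ] Lp ℂ 2 (volume : Measure (Fin n → ℝ)) :=
  (LinearIsometryEquiv.ofSurjective
    (⟨(bargmannCLM n).toLinearMap, norm_bargmannCLM⟩ :
      Lp ℂ 2 (volume : Measure (Fin n → ℝ)) →ₗᵢ[ℂ] Fock n) (surjective_bargmannCLM n)).symm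

theorem isBargmann_bargmann (n : ℕ) : IsBargmann (bargmann n) := fun φ z =>
  congrFun (entire_bargmannFun φ) z

theorem bargmann_kernelFock {n : ℕ} (w : Fin n → ℂ) :
    bargmann n (kernelFock w) = coherentLp (star w) := by
  rw [← bargmannCLM_coherentLp]
  exact (bargmann n).apply_symm_apply _

theorem entire_eq_integral_bargmann {n : ℕ} (f : Fock n) (z : Fin n → ℂ) :
    entire f z = ∫ x, bargmann n f x * coherent z x := by
  rw [← bargmannStar_eq, ← isBargmann_bargmann, LinearIsometryEquiv.symm_apply_apply]

/-! ### Multiplication operators -/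

/-- A bounded operator on `L₂` that agrees with multiplication by `γ` on the coherent states is
multiplication by `γ`, and `γ` is essentially bounded. -/
theorem eq_mul_of_coherentLp {n : ℕ} {γ : (Fin n → ℝ) → ℂ} (hγ : AEStronglyMeasurable γ volume)
    (S : Lp ℂ 2 (volume : Measure (Fin n → ℝ)) →L[ℂ] Lp ℂ 2 (volume : Measure (Fin n → ℝ)))
    (hS : ∀ a, S (coherentLp a) =ᵐ[volume] fun x => γ x * coherent a x) :
    MemLp γ ⊤ volume ∧ ∀ φ, S φ =ᵐ[volume] fun x => γ x * φ x := by
  -- The functions on which `S` acts as multiplication by `γ` form a closed subspace.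
  let V : Submodule ℂ (Lp ℂ 2 (volume : Measure (Fin n → ℝ))) :=
    { carrier := {φ | S φ =ᵐ[volume] fun x => γ x * φ x}
      zero_mem' := by
        simp only [Set.mem_ofPred_eq, map_zero]
        filter_upwards [Lp.coeFn_zero ℂ 2 (volume : Measure (Fin n → ℝ))] with x hx
        rw [hx, Pi.zero_apply, mul_zero]
      add_mem' := fun {φ ψ} h1 h2 => by
        simp only [Set.mem_ofPred_eq, map_add] at *
        filter_upwards [h1, h2, Lp.coeFn_add φ ψ, Lp.coeFn_add (S φ) (S ψ)] with x a b c d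
        rw [c, d, Pi.add_apply, Pi.add_apply, a, b, mul_add]
      smul_mem' := fun c φ h1 => by
        simp only [Set.mem_ofPred_eq, map_smul] at *
        filter_upwards [h1, Lp.coeFn_smul c φ, Lp.coeFn_smul c (S φ)] with x a b d
        rw [b, d, Pi.smul_apply, Pi.smul_apply, a, smul_eq_mul, smul_eq_mul, mul_left_comm] }
  have hcl : IsClosed (V : Set (Lp ℂ 2 (volume : Measure (Fin n → ℝ)))) := by
    refine IsSeqClosed.isClosed fun s φ hs hlim => ?_
    obtain ⟨ns, hns, h1⟩ := (tendstoInMeasure_of_tendsto_Lp hlim).exists_seq_tendsto_ae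
    have hlim2 : Tendsto (fun i => S (s (ns i))) atTop (𝓝 (S φ)) :=
      (S.continuous.tendsto φ).comp (hlim.comp hns.tendsto_atTop)
    obtain ⟨ms, hms, h2⟩ := (tendstoInMeasure_of_tendsto_Lp hlim2).exists_seq_tendsto_ae
    have h3 : ∀ᵐ x, ∀ i, S (s i) x = γ x * s i x := ae_all_iff.2 fun i => hs i
    change S φ =ᵐ[volume] fun x => γ x * φ x
    filter_upwards [h1, h2, h3] with x a b c
    simp only [c] at b
    exact tendsto_nhds_unique b ((a.comp hms.tendsto_atTop).const_mul (γ x))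
  have hall : ∀ φ, S φ =ᵐ[volume] fun x => γ x * φ x := fun φ => by
    have hle : (Submodule.span ℂ (Set.range (coherentLp (n := n)))).topologicalClosure ≤ V := by
      refine Submodule.topologicalClosure_minimal _ (Submodule.span_le.2 ?_) hcl
      rintro _ ⟨a, rfl⟩
      refine (hS a).trans ?_
      filter_upwards [coherentLp_coe a] with x hx
      rw [hx]
    rw [dense_span_coherentLp] at hle
    exact hle (Submodule.mem_top (x := φ))
  refine ⟨memLp_top_of_bound hγ ‖S‖ ?_, hall⟩
  -- Testing `‖S φ‖ ≤ ‖S‖ ‖φ‖` on indicator functions gives `|γ| ≤ ‖S‖` almost everywhere.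
  have hsq : ∀ᵐ x, ‖γ x‖ₑ ^ 2 ≤ ENNReal.ofReal (‖S‖ ^ 2) := by
    refine ae_le_of_forall_setLIntegral_le_of_sigmaFinite₀ (hγ.enorm.pow_const 2)
      fun s hs hfin => ?_
    set φ : Lp ℂ 2 (volume : Measure (Fin n → ℝ)) := indicatorConstLp 2 hs hfin.ne (1 : ℂ)
    have hn : ∀ ψ : Lp ℂ 2 (volume : Measure (Fin n → ℝ)),
        ∫⁻ x, ‖ψ x‖ₑ ^ 2 = ENNReal.ofReal (‖ψ‖ ^ 2) := fun ψ => by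
      have h := eLpNorm_nnreal_pow_eq_lintegral (p := 2) (f := ψ)
        (μ := (volume : Measure (Fin n → ℝ))) (by norm_num)
      simp only [NNReal.coe_ofNat, ENNReal.rpow_ofNat, ENNReal.coe_ofNat] at h
      rw [← h, Lp.norm_def, ENNReal.ofReal_pow ENNReal.toReal_nonneg,
        ENNReal.ofReal_toReal (Lp.eLpNorm_ne_top _)]
    have h1 : ∫⁻ x in s, ‖γ x‖ₑ ^ 2 = ∫⁻ x, ‖S φ x‖ₑ ^ 2 := by
      rw [← lintegral_indicator hs]
      refine lintegral_congr_ae ?_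
      filter_upwards [hall φ, indicatorConstLp_coeFn (p := 2) (hs := hs) (hμs := hfin.ne)
        (c := (1 : ℂ))] with x a b
      rw [a, b]
      by_cases hx : x ∈ s <;> simp [hx]
    have h2 : ‖φ‖ ^ 2 = (volume s).toReal := by
      rw [norm_indicatorConstLp (by norm_num) (by norm_num)]
      simp only [norm_one, one_mul, ENNReal.toReal_ofNat, measureReal_def, ← Real.sqrt_eq_rpow,
        Real.sq_sqrt ENNReal.toReal_nonneg]
    rw [h1, hn, setLIntegral_const, ← ENNReal.ofReal_toReal hfin.ne,
      ← ENNReal.ofReal_mul (by positivity), ← h2, ← mul_pow]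
    exact ENNReal.ofReal_le_ofReal (by gcongr; exact S.le_opNorm φ)
  filter_upwards [hsq] with x hx
  rw [← ofReal_norm, ← ENNReal.ofReal_pow (norm_nonneg _),
    ENNReal.ofReal_le_ofReal_iff (by positivity)] at hx
  exact (pow_le_pow_iff_left₀ (norm_nonneg _) (norm_nonneg _) two_ne_zero).1 hx

/-! ### Derivatives of the Gaussian -/

/-- The derivative of order `m` of `e^{-t²}`. -/
def gaussDeriv (m : ℕ) : ℝ → ℝ := iteratedDeriv m fun s : ℝ => Real.exp (-s ^ 2)

theorem contDiff_gaussDeriv_zero : ContDiff ℝ ⊤ fun s : ℝ => Real.exp (-s ^ 2) := by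
  fun_prop

theorem hasDerivAt_gaussDeriv (m : ℕ) (t : ℝ) :
    HasDerivAt (gaussDeriv m) (gaussDeriv (m + 1) t) t := by
  rw [gaussDeriv, gaussDeriv, iteratedDeriv_succ]
  exact (contDiff_gaussDeriv_zero.differentiable_iteratedDeriv m (WithTop.coe_lt_top _) t).hasDerivAt

theorem continuous_gaussDeriv (m : ℕ) : Continuous (gaussDeriv m) :=
  continuous_iff_continuousAt.2 fun t => (hasDerivAt_gaussDeriv m t).continuousAt

theorem gaussDeriv_eq_polynomial (m : ℕ) :
    ∃ p : Polynomial ℝ, ∀ t, gaussDeriv m t = p.eval t * Real.exp (-t ^ 2) := by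
  induction m with
  | zero => exact ⟨1, fun t => by simp [gaussDeriv]⟩
  | succ m ih =>
    obtain ⟨p, hp⟩ := ih
    refine ⟨p.derivative - 2 * Polynomial.X * p, fun t => ?_⟩
    have h1 : HasDerivAt (fun t => p.eval t * Real.exp (-t ^ 2)) (p.derivative.eval t *
        Real.exp (-t ^ 2) + p.eval t * (Real.exp (-t ^ 2) * (-(2 * t)))) t := by
      refine (p.hasDerivAt t).mul ?_
      have := ((hasDerivAt_pow 2 t).neg).exp
      simpa using this
    have h2 := hasDerivAt_gaussDeriv m t
    rw [show gaussDeriv m = _ from funext hp] at h2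
    rw [h2.unique h1]
    simp
    ring

theorem exists_abs_gaussDeriv_le (m : ℕ) :
    ∃ C, ∀ t, |gaussDeriv m t| ≤ C * Real.exp (-(1 / 2) * t ^ 2) := by
  obtain ⟨p, hp⟩ := gaussDeriv_eq_polynomial m
  obtain ⟨C, hC⟩ : ∃ C, ∀ t, |p.eval t| ≤ C * Real.exp (t ^ 2 / 2) := by
    clear hp
    induction p using Polynomial.induction_on' with
    | add p q hp hq =>
      obtain ⟨C, hC⟩ := hp
      obtain ⟨D, hD⟩ := hq
      refine ⟨C + D, fun t => ?_⟩
      rw [Polynomial.eval_add, add_mul]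
      exact (abs_add_le _ _).trans (add_le_add (hC t) (hD t))
    | monomial k a =>
      refine ⟨|a| * (k.factorial * Real.exp (1 / 2)), fun t => ?_⟩
      rw [Polynomial.eval_monomial, abs_mul, abs_pow, mul_assoc]
      refine mul_le_mul_of_nonneg_left ?_ (abs_nonneg a)
      have h1 := Real.pow_div_factorial_le_exp |t| (abs_nonneg t) k
      rw [div_le_iff₀ (by positivity)] at h1
      refine h1.trans ?_
      rw [mul_assoc, ← Real.exp_add, mul_comm]
      gcongr
      nlinarith [sq_nonneg (|t| - 1), sq_abs t]
  refine ⟨C, fun t => ?_⟩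
  rw [hp, abs_mul, Real.abs_exp]
  calc |p.eval t| * Real.exp (-t ^ 2) ≤ C * Real.exp (t ^ 2 / 2) * Real.exp (-t ^ 2) := by
        gcongr
        exact hC t
    _ = C * Real.exp (-(1 / 2) * t ^ 2) := by
        rw [mul_assoc, ← Real.exp_add]
        congr 2
        ring

theorem integrable_gaussDeriv_mul (m : ℕ) (a : ℂ) :
    Integrable fun t : ℝ => (gaussDeriv m t : ℂ) * Complex.exp (a * t) := by
  obtain ⟨C, hC⟩ := exists_abs_gaussDeriv_le m
  have h := (integrable_cexp_quadratic (b := 1 / 2) (by simp) (a.re : ℂ) 0).norm.const_mul C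
  have hc := continuous_gaussDeriv m
  refine h.mono' (Continuous.aestronglyMeasurable (by fun_prop)) (Eventually.of_forall fun t => ?_)
  rw [norm_mul, Complex.norm_real, Real.norm_eq_abs, Complex.norm_exp, Complex.norm_exp,
    add_zero, Complex.add_re, Real.exp_add, ← mul_assoc]
  have h1 : (-(1 / 2 : ℂ) * (t : ℂ) ^ 2).re = -(1 / 2) * t ^ 2 := by
    have : (-(1 / 2 : ℂ) * (t : ℂ) ^ 2) = ((-(1 / 2) * t ^ 2 : ℝ) : ℂ) := by push_cast; rfl
    rw [this, Complex.ofReal_re]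
  have h2 : ((a.re : ℂ) * t).re = (a * t).re := by simp
  rw [h1, h2]
  gcongr
  exact hC t

theorem integral_gaussDeriv_mul (m : ℕ) (a : ℂ) :
    ∫ t : ℝ, (gaussDeriv m t : ℂ) * Complex.exp (a * t) =
      (-a) ^ m * (Real.sqrt Real.pi * Complex.exp (a ^ 2 / 4)) := by
  induction m with
  | zero =>
    have h := integral_cexp_quadratic (b := -1) (by simp) a 0
    have h1 : ((Real.pi : ℂ) / - -1) ^ (1 / 2 : ℂ) = Real.sqrt Real.pi := by
      rw [neg_neg, div_one, Real.sqrt_eq_rpow, Complex.ofReal_cpow Real.pi_pos.le]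
      simp
    rw [h1] at h
    rw [pow_zero, one_mul]
    convert! h using 1
    · refine integral_congr_ae (Eventually.of_forall fun t => ?_)
      simp only [gaussDeriv, iteratedDeriv_zero, Complex.ofReal_exp, ← Complex.exp_add]
      congr 1
      push_cast
      ring
    · congr 2
      ring
  | succ m ih =>
    have hparts := integral_mul_deriv_eq_deriv_mul_of_integrable
      (u := fun t : ℝ => (gaussDeriv m t : ℂ)) (v := fun t : ℝ => Complex.exp (a * t))
      (u' := fun t : ℝ => (gaussDeriv (m + 1) t : ℂ)) (v' := fun t : ℝ => a * Complex.exp (a * t))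
      (fun t _ => (hasDerivAt_gaussDeriv m t).ofReal_comp) (fun t _ => ?_) ?_
      (integrable_gaussDeriv_mul (m + 1) a) (integrable_gaussDeriv_mul m a)
    · have h1 : ∀ t : ℝ, (gaussDeriv m t : ℂ) * (a * Complex.exp (a * t)) =
          a * ((gaussDeriv m t : ℂ) * Complex.exp (a * t)) := fun t => by ring
      simp only [h1] at hparts
      rw [integral_const_mul, ih] at hparts
      rw [← neg_eq_iff_eq_neg.2 hparts, pow_succ]
      ring
    · have h1 : HasDerivAt (fun t : ℝ => a * (t : ℂ)) a t := by
        simpa using (Complex.ofRealCLM.hasDerivAt (x := t)).const_mul a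
      simpa [mul_comm] using h1.cexp
    · refine ((integrable_gaussDeriv_mul m a).const_mul a).congr (Eventually.of_forall fun t => ?_)
      simp only [Pi.mul_apply]
      ring

/-! ### The spectral function -/

/-- Completing the square separates the Gaussian factor in `y`, which ensures convergence, from a
bounded function of `√2 x - y`. -/
theorem gammaIntegrand_eq {n : ℕ} (m : Fin n → ℕ) (x y : Fin n → ℝ) :
    gammaIntegrand m x y = ((Real.exp (∑ j, x j ^ 2) * (Real.exp (-∑ j, y j ^ 2) *
      ∏ j, ((-1) ^ m j * gaussDeriv (m j) (Real.sqrt 2 * x j - y j))) : ℝ) : ℂ) := by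
  rw [gammaIntegrand, hermiteProd]
  congr 1
  rw [← Finset.sum_neg_distrib, ← Finset.sum_neg_distrib, Real.exp_sum, Real.exp_sum,
    Real.exp_sum, ← Finset.prod_mul_distrib, ← Finset.prod_mul_distrib, ← Finset.prod_mul_distrib]
  refine Finset.prod_congr rfl fun j _ => ?_
  have h : Real.exp ((Real.sqrt 2 * x j - y j) ^ 2) * Real.exp (-(x j - Real.sqrt 2 * y j) ^ 2) =
      Real.exp (x j ^ 2) * Real.exp (-y j ^ 2) := by
    rw [← Real.exp_add, ← Real.exp_add]
    congr 1
    have := Real.sq_sqrt (show (0 : ℝ) ≤ 2 by norm_num)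
    linear_combination (x j ^ 2 - y j ^ 2) * this
  rw [gaussDeriv]
  linear_combination (-1) ^ m j * iteratedDeriv (m j) (fun s => Real.exp (-s ^ 2))
    (Real.sqrt 2 * x j - y j) * h

theorem continuous_gammaIntegrand {n : ℕ} (m : Fin n → ℕ) :
    Continuous fun p : (Fin n → ℝ) × (Fin n → ℝ) => gammaIntegrand m p.1 p.2 := by
  simp only [gammaIntegrand_eq]
  have := fun j => continuous_gaussDeriv (m j)
  fun_prop

theorem stronglyMeasurable_gammaFn {n : ℕ} (ϱ : ComplexRadonMeasure (Fin n → ℝ))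
    (m : Fin n → ℕ) : StronglyMeasurable (gammaFn ϱ m) := by
  have := ϱ.isLocallyFinite
  have h : StronglyMeasurable fun p : (Fin n → ℝ) × (Fin n → ℝ) =>
      gammaIntegrand m p.1 p.2 * ϱ.phase p.2 :=
    ((continuous_gammaIntegrand m).measurable.mul
      (ϱ.measurable_phase.comp measurable_snd)).stronglyMeasurable
  exact h.integral_prod_right.const_mul _

/-- The Gaussian moments of `|ϱ|` are finite. -/
def HasGaussianMoments {n : ℕ} (ϱ : ComplexRadonMeasure (Fin n → ℝ)) : Prop :=
  ∀ c : Fin n → ℝ, Integrable (fun y => Real.exp (-∑ j, y j ^ 2 + ∑ j, c j * y j)) ϱ.variation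

theorem integrable_gammaIntegrand {n : ℕ} {ϱ : ComplexRadonMeasure (Fin n → ℝ)}
    (hϱ : HasGaussianMoments ϱ) (m : Fin n → ℕ) (x : Fin n → ℝ) :
    Integrable (gammaIntegrand m x) ϱ.variation := by
  choose C hC using fun j => exists_abs_gaussDeriv_le (m j)
  have hC0 : ∀ j, 0 ≤ C j := fun j => by
    have := (abs_nonneg _).trans (hC j 0)
    simpa using this
  have hc : Continuous fun y => gammaIntegrand m x y := by
    simp only [gammaIntegrand_eq]
    have := fun j => continuous_gaussDeriv (m j)
    fun_prop
  have h0 : Integrable (fun y => Real.exp (∑ j, x j ^ 2) *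
      (Real.exp (-∑ j, y j ^ 2) * ∏ j, C j)) ϱ.variation := by
    have := hϱ 0
    simp only [Pi.zero_apply, zero_mul, Finset.sum_const_zero, add_zero] at this
    exact (this.mul_const _).const_mul _
  refine h0.mono' hc.aestronglyMeasurable (Eventually.of_forall fun y => ?_)
  rw [gammaIntegrand_eq, Complex.norm_real, Real.norm_eq_abs, abs_mul, abs_mul, Real.abs_exp,
    Real.abs_exp, Finset.abs_prod]
  simp only [abs_mul, abs_pow, abs_neg,
    abs_one, one_pow, one_mul]
  gcongr with j _
  refine (hC j _).trans (mul_le_of_le_one_right (hC0 j) ?_)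
  rw [Real.exp_le_one_iff]
  nlinarith [sq_nonneg (Real.sqrt 2 * x j - y j)]

/-- The product `∏ⱼ H_{mⱼ}(tⱼ) e^{-tⱼ² + cⱼ tⱼ}`. -/
def hermiteExp {n : ℕ} (m : Fin n → ℕ) (c : Fin n → ℂ) (t : Fin n → ℝ) : ℂ :=
  ∏ j, (-1) ^ m j * ((gaussDeriv (m j) (t j) : ℂ) * Complex.exp (c j * t j))

theorem continuous_hermiteExp {n : ℕ} (m : Fin n → ℕ) (c : Fin n → ℂ) :
    Continuous (hermiteExp m c) := by
  have := fun j => continuous_gaussDeriv (m j)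
  unfold hermiteExp
  fun_prop

theorem integrable_hermiteExp {n : ℕ} (m : Fin n → ℕ) (c : Fin n → ℂ) :
    Integrable (hermiteExp m c) :=
  Integrable.fintype_prod
    (f := fun j t => (-1) ^ m j * ((gaussDeriv (m j) t : ℂ) * Complex.exp (c j * t)))
    fun j => (integrable_gaussDeriv_mul (m j) (c j)).const_mul _

theorem integral_hermiteExp {n : ℕ} (m : Fin n → ℕ) (c : Fin n → ℂ) :
    ∫ t, hermiteExp m c t =
      (Real.sqrt Real.pi : ℂ) ^ n * Complex.exp (∑ j, c j ^ 2 / 4) * ∏ j, c j ^ m j := by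
  have h := integral_fintype_prod_volume_eq_prod (ι := Fin n)
    fun j (t : ℝ) => (-1 : ℂ) ^ m j * ((gaussDeriv (m j) t : ℂ) * Complex.exp (c j * t))
  refine h.trans ?_
  simp only [integral_const_mul, integral_gaussDeriv_mul]
  have h2 : ∀ j, (-1 : ℂ) ^ m j * ((-c j) ^ m j * (Real.sqrt Real.pi *
      Complex.exp (c j ^ 2 / 4))) = Real.sqrt Real.pi * Complex.exp (c j ^ 2 / 4) * c j ^ m j :=
    fun j => by
      rw [← mul_assoc, ← mul_pow]
      ring
  simp only [h2]
  rw [Finset.prod_mul_distrib, Finset.prod_mul_distrib, Complex.exp_sum]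
  simp

theorem gammaIntegrand_mul_coherent {n : ℕ} (m : Fin n → ℕ) (a b : Fin n → ℂ) (x y : Fin n → ℝ) :
    gammaIntegrand m x y * (coherent a x * coherent b x) =
      ((Real.pi ^ (-(n : ℝ) / 2) : ℝ) : ℂ) * Complex.exp (-∑ j, (a j ^ 2 + b j ^ 2) / 2) *
        (Complex.exp (-∑ j, (y j : ℂ) ^ 2 + ∑ j, (a j + b j) * y j) *
          hermiteExp m (a + b) (Real.sqrt 2 • x - y)) := by
  rw [gammaIntegrand_eq, coherent_mul, hermiteExp, mul_left_comm]
  congr 1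
  push_cast
  simp only [Finset.prod_mul_distrib]
  rw [← Complex.exp_sum]
  have h : Complex.exp (∑ j, (x j : ℂ) ^ 2) * Complex.exp (-∑ j, (y j : ℂ) ^ 2) *
      Complex.exp (-1 * ∑ j, (x j : ℂ) ^ 2 + ∑ j, (Real.sqrt 2 * (a j + b j)) * x j) =
      Complex.exp (-∑ j, (y j : ℂ) ^ 2 + ∑ j, (a j + b j) * y j) *
        Complex.exp (∑ j, (a + b) j * ((Real.sqrt 2 • x - y) j : ℝ)) := by
    rw [← Complex.exp_add, ← Complex.exp_add, ← Complex.exp_add]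
    congr 1
    have h1 : ∑ j, (a + b) j * (((Real.sqrt 2 • x - y) j : ℝ) : ℂ) =
        ∑ j, (Real.sqrt 2 * (a j + b j)) * (x j : ℂ) - ∑ j, (a j + b j) * (y j : ℂ) := by
      rw [← Finset.sum_sub_distrib]
      refine Finset.sum_congr rfl fun j _ => ?_
      simp
      ring
    rw [h1]
    ring
  simp only [Pi.sub_apply, Pi.smul_apply, smul_eq_mul] at h ⊢
  linear_combination (∏ j, (-1 : ℂ) ^ m j) *
    (∏ j, (gaussDeriv (m j) (Real.sqrt 2 * x j - y j) : ℂ)) * h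

theorem integrable_gaussianMoment {n : ℕ} {ϱ : ComplexRadonMeasure (Fin n → ℝ)}
    (hϱ : HasGaussianMoments ϱ) (c : Fin n → ℂ) :
    Integrable (fun y => Complex.exp (-∑ j, (y j : ℂ) ^ 2 + ∑ j, c j * y j) * ϱ.phase y)
      ϱ.variation := by
  have hc : Continuous fun y : Fin n → ℝ =>
    Complex.exp (-∑ j, (y j : ℂ) ^ 2 + ∑ j, c j * y j) := by fun_prop
  refine (hϱ fun j => (c j).re).mono'
    (hc.measurable.mul ϱ.measurable_phase).aestronglyMeasurable (Eventually.of_forall fun y => ?_)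
  rw [norm_mul, ϱ.norm_phase, mul_one, Complex.norm_exp]
  refine le_of_eq (congrArg Real.exp ?_)
  simp [← Complex.ofReal_pow, Complex.re_sum]

/-- Absolute convergence behind Fubini's theorem: the integral over `x` of the modulus of the last
factor does not depend on `y`. -/
theorem integrable_gammaFn_kernel {n : ℕ} {ϱ : ComplexRadonMeasure (Fin n → ℝ)}
    (hϱ : HasGaussianMoments ϱ) (m : Fin n → ℕ) (c : Fin n → ℂ) :
    Integrable (fun p : (Fin n → ℝ) × (Fin n → ℝ) =>
      Complex.exp (-∑ j, (p.2 j : ℂ) ^ 2 + ∑ j, c j * p.2 j) * ϱ.phase p.2 *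
        hermiteExp m c (Real.sqrt 2 • p.1 - p.2)) (volume.prod ϱ.variation) := by
  have := ϱ.isLocallyFinite
  have hc : Continuous fun p : (Fin n → ℝ) × (Fin n → ℝ) =>
    Complex.exp (-∑ j, (p.2 j : ℂ) ^ 2 + ∑ j, c j * p.2 j) := by fun_prop
  have hh : Continuous fun p : (Fin n → ℝ) × (Fin n → ℝ) =>
      hermiteExp m c (Real.sqrt 2 • p.1 - p.2) :=
    (continuous_hermiteExp m c).comp (by fun_prop)
  have h2 : Real.sqrt 2 ≠ 0 := by simp
  have hmeas : Measurable fun p : (Fin n → ℝ) × (Fin n → ℝ) =>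
      Complex.exp (-∑ j, (p.2 j : ℂ) ^ 2 + ∑ j, c j * p.2 j) * ϱ.phase p.2 *
        hermiteExp m c (Real.sqrt 2 • p.1 - p.2) :=
    (hc.measurable.mul (ϱ.measurable_phase.comp measurable_snd)).mul hh.measurable
  rw [integrable_prod_iff' hmeas.aestronglyMeasurable]
  refine ⟨Eventually.of_forall fun y => ?_, ?_⟩
  · exact (((integrable_hermiteExp m c).comp_sub_right y).comp_smul h2).const_mul
      (Complex.exp (-∑ j, (y j : ℂ) ^ 2 + ∑ j, c j * y j) * ϱ.phase y)
  · simp only [norm_mul, integral_const_mul]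
    have h3 : ∀ y, ∫ x : Fin n → ℝ, ‖hermiteExp m c (Real.sqrt 2 • x - y)‖ =
        |(Real.sqrt 2 ^ Module.finrank ℝ (Fin n → ℝ))⁻¹| • ∫ x, ‖hermiteExp m c x‖ := fun y => by
      rw [Measure.integral_comp_smul volume (fun x => ‖hermiteExp m c (x - y)‖) (Real.sqrt 2),
        integral_sub_right_eq_self (fun x => ‖hermiteExp m c x‖) y]
    simp only [h3, ← norm_mul]
    exact (integrable_gaussianMoment hϱ c).norm.mul_const _

theorem gammaFn_mul_coherent {n : ℕ} (ϱ : ComplexRadonMeasure (Fin n → ℝ)) (m : Fin n → ℕ)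
    (a b : Fin n → ℂ) (x : Fin n → ℝ) :
    gammaFn ϱ m x * coherent a x * coherent b x =
      ((((2 / Real.pi) ^ ((n : ℝ) / 2) : ℝ) : ℂ) * (((Real.pi ^ (-(n : ℝ) / 2) : ℝ) : ℂ) *
        Complex.exp (-∑ j, (a j ^ 2 + b j ^ 2) / 2))) *
        ∫ y, Complex.exp (-∑ j, (y j : ℂ) ^ 2 + ∑ j, (a + b) j * y j) * ϱ.phase y *
          hermiteExp m (a + b) (Real.sqrt 2 • x - y) ∂ϱ.variation := by
  rw [gammaFn, ComplexRadonMeasure.integral, mul_assoc, mul_assoc, mul_assoc, ← integral_mul_const]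
  refine congrArg _ ?_
  rw [← integral_const_mul]
  refine integral_congr_ae (Eventually.of_forall fun y => ?_)
  have := gammaIntegrand_mul_coherent m a b x y
  simp only [Pi.add_apply] at this ⊢
  linear_combination ϱ.phase y * this

theorem integrable_gammaFn_mul_coherent {n : ℕ} {ϱ : ComplexRadonMeasure (Fin n → ℝ)}
    (hϱ : HasGaussianMoments ϱ) (m : Fin n → ℕ) (a b : Fin n → ℂ) :
    Integrable fun x => gammaFn ϱ m x * coherent a x * coherent b x := by
  have := ϱ.isLocallyFinite
  simp only [gammaFn_mul_coherent]
  exact (integrable_gammaFn_kernel hϱ m (a + b)).integral_prod_left.const_mul _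

theorem rpow_half_eq {x : ℝ} (hx : 0 ≤ x) (n : ℕ) : x ^ ((n : ℝ) / 2) = Real.sqrt x ^ n := by
  rw [Real.sqrt_eq_rpow, ← Real.rpow_natCast, ← Real.rpow_mul hx]
  congr 1
  ring

/-- The matrix elements of multiplication by `γ` in the coherent states. Integrating over `x` first,
the translate of `H_m(t) e^{-t²}` gives its Laplace transform, a monomial times a Gaussian. -/
theorem integral_gammaFn_mul_coherent {n : ℕ} {ϱ : ComplexRadonMeasure (Fin n → ℝ)}
    (hϱ : HasGaussianMoments ϱ) (m : Fin n → ℕ) (a b : Fin n → ℂ) :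
    ∫ x, gammaFn ϱ m x * coherent a x * coherent b x =
      ((Real.pi ^ (-(n : ℝ) / 2) : ℝ) : ℂ) * Complex.exp (-∑ j, (a j - b j) ^ 2 / 4) *
        (∏ j, (a j + b j) ^ m j) *
        ϱ.integral fun y => Complex.exp (-∑ j, (y j : ℂ) ^ 2 + ∑ j, (a j + b j) * y j) := by
  have := ϱ.isLocallyFinite
  simp only [gammaFn_mul_coherent]
  rw [integral_const_mul, integral_integral_swap (integrable_gammaFn_kernel hϱ m (a + b))]
  have h1 : ∀ y, ∫ x : Fin n → ℝ, hermiteExp m (a + b) (Real.sqrt 2 • x - y) =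
      (Real.sqrt 2 ^ n : ℂ)⁻¹ * ∫ x, hermiteExp m (a + b) x := fun y => by
    rw [Measure.integral_comp_smul volume (fun x => hermiteExp m (a + b) (x - y)) (Real.sqrt 2),
      integral_sub_right_eq_self (fun x => hermiteExp m (a + b) x) y, Complex.real_smul,
      abs_of_nonneg (by positivity)]
    simp
  simp only [integral_const_mul, h1]
  rw [integral_mul_const, integral_hermiteExp, ComplexRadonMeasure.integral]
  simp only [Pi.add_apply]
  have h2 : Complex.exp (-∑ j, (a j ^ 2 + b j ^ 2) / 2) * Complex.exp (∑ j, (a j + b j) ^ 2 / 4) =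
      Complex.exp (-∑ j, (a j - b j) ^ 2 / 4) := by
    rw [← Complex.exp_add, ← Finset.sum_neg_distrib, ← Finset.sum_neg_distrib,
      ← Finset.sum_add_distrib]
    congr 1
    refine Finset.sum_congr rfl fun j _ => ?_
    ring
  have h3 : (((2 / Real.pi) ^ ((n : ℝ) / 2) : ℝ) : ℂ) * (Real.sqrt 2 ^ n : ℂ)⁻¹ *
      (Real.sqrt Real.pi : ℂ) ^ n = 1 := by
    rw [rpow_half_eq (by positivity), Real.sqrt_div (by norm_num)]
    have h4 : (Real.sqrt 2 : ℂ) ≠ 0 := by simp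
    have h5 : (Real.sqrt Real.pi : ℂ) ≠ 0 := by
      rw [Complex.ofReal_ne_zero]
      exact (Real.sqrt_pos.2 Real.pi_pos).ne'
    push_cast
    rw [div_pow]
    field_simp
  rw [← h2]
  generalize (∫ y, Complex.exp (-∑ j, (y j : ℂ) ^ 2 + ∑ j, (a j + b j) * y j) * ϱ.phase y
    ∂ϱ.variation) = J
  linear_combination ((Real.pi ^ (-(n : ℝ) / 2) : ℝ) : ℂ) *
    Complex.exp (-∑ j, (a j ^ 2 + b j ^ 2) / 2) * Complex.exp (∑ j, (a j + b j) ^ 2 / 4) *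
    (∏ j, (a j + b j) ^ m j) * J * h3

/-! ### The form of the real coderivative on the reproducing kernels -/

theorem integral_horizontal {n : ℕ} (ϱ : ComplexRadonMeasure (Fin n → ℝ))
    {f : (Fin n → ℂ) → ℂ} {A C : (Fin n → ℝ) → ℂ}
    (hf : ∀ s t, f (toComplexHomeo n (s, t)) = A s * C t) :
    (horizontal ϱ).integral f = ϱ.integral A * ∫ t, C t := by
  have := ϱ.isLocallyFinite
  have hE : MeasurableEmbedding (toComplexHomeo n) := (toComplexHomeo n).measurableEmbedding
  rw [ComplexRadonMeasure.integral, ComplexRadonMeasure.integral, ← integral_prod_mul]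
  refine (hE.integral_map _).trans (integral_congr_ae (Eventually.of_forall fun p => ?_))
  change f (toComplexHomeo n (p.1, p.2)) * ϱ.phase p.1 = _
  rw [hf]
  ring

theorem sqNorm_toComplexHomeo {n : ℕ} (s t : Fin n → ℝ) :
    sqNorm (toComplexHomeo n (s, t)) = ∑ j, s j ^ 2 + ∑ j, t j ^ 2 := by
  rw [sqNorm, ← Finset.sum_add_distrib]
  refine Finset.sum_congr rfl fun j _ => ?_
  simp [toComplexHomeo, Complex.sq_norm, Complex.normSq_apply]
  ring

theorem toComplexHomeo_apply {n : ℕ} (s t : Fin n → ℝ) (j : Fin n) :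
    toComplexHomeo n (s, t) j = s j + t j * Complex.I := by
  simp [toComplexHomeo, Complex.ext_iff]

theorem kernel_mul_star_kernel {n : ℕ} (w z : Fin n → ℂ) (s t : Fin n → ℝ) :
    kernel w (toComplexHomeo n (s, t)) * star (kernel z (toComplexHomeo n (s, t))) *
      (Real.exp (-sqNorm (toComplexHomeo n (s, t))) : ℂ) =
      Complex.exp (-∑ j, (s j : ℂ) ^ 2 + ∑ j, (star (w j) + z j) * s j) *
        Complex.exp (-1 * ∑ j, (t j : ℂ) ^ 2 + ∑ j, (Complex.I * (star (w j) - z j)) * t j) := by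
  rw [kernel, kernel, ← starRingEnd_apply (Complex.exp _), ← Complex.exp_conj,
    sqNorm_toComplexHomeo, Complex.ofReal_exp, ← Complex.exp_add, ← Complex.exp_add,
    ← Complex.exp_add, map_sum]
  congr 1
  push_cast
  rw [neg_add, ← Finset.sum_neg_distrib, ← Finset.sum_neg_distrib, neg_one_mul,
    ← Finset.sum_neg_distrib]
  simp only [← Finset.sum_add_distrib]
  refine Finset.sum_congr rfl fun j _ => ?_
  rw [toComplexHomeo_apply]
  simp
  ring

theorem sum_choose_mul_pow {n : ℕ} (m : Fin n → ℕ) (a b : Fin n → ℂ) :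
    ∑ β ∈ Finset.Icc 0 m, ((∏ j, (m j).choose (β j) : ℕ) : ℂ) *
      ((∏ j, a j ^ (m - β) j) * ∏ j, b j ^ β j) = ∏ j, (a j + b j) ^ m j := by
  have h : ∀ j, (a j + b j) ^ m j = ∑ i ∈ Finset.Icc 0 (m j),
      ((m j).choose i : ℂ) * (a j ^ (m j - i) * b j ^ i) := fun j => by
    rw [add_comm, add_pow, Finset.range_eq_Ico, ← Finset.Ico_add_one_right_eq_Icc]
    refine Finset.sum_congr rfl fun i _ => ?_
    ring
  simp only [h]
  rw [Finset.prod_univ_sum]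
  refine Finset.sum_congr rfl fun β _ => ?_
  simp only [Finset.prod_mul_distrib, Pi.sub_apply]
  push_cast
  rfl

/-- On reproducing kernels the derivatives in the form become powers of `w̄` and `z`, which the
binomial coefficients assemble into `(w̄ + z)^m`. -/
theorem realCoderivForm_kernel {n : ℕ} (ϱ : ComplexRadonMeasure (Fin n → ℝ)) (m : Fin n → ℕ)
    (w z : Fin n → ℂ) :
    realCoderivForm (horizontal ϱ) m (kernel w) (kernel z) =
      ((Real.pi ^ (-(n : ℝ) / 2) : ℝ) : ℂ) * Complex.exp (-∑ j, (star (w j) - z j) ^ 2 / 4) *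
        (∏ j, (star (w j) + z j) ^ m j) *
        ϱ.integral fun y => Complex.exp (-∑ j, (y j : ℂ) ^ 2 + ∑ j, (star (w j) + z j) * y j) := by
  set J := ϱ.integral fun y => Complex.exp (-∑ j, (y j : ℂ) ^ 2 + ∑ j, (star (w j) + z j) * y j)
  have hform : ∀ α β, coderivForm (horizontal ϱ) α β (kernel w) (kernel z) =
      ((∏ j, star (w j) ^ α j) * ∏ j, z j ^ β j) * (((Real.pi : ℂ) ^ n)⁻¹ * (J *
        ((Real.pi : ℂ) ^ ((n : ℂ) / 2) * Complex.exp (-∑ j, (star (w j) - z j) ^ 2 / 4)))) :=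
      fun α β => by
    have h := integral_horizontal ϱ (f := coderivIntegrand α β (kernel w) (kernel z))
      (A := fun s => ((∏ j, star (w j) ^ α j) * ∏ j, z j ^ β j) *
        Complex.exp (-∑ j, (s j : ℂ) ^ 2 + ∑ j, (star (w j) + z j) * s j))
      (C := fun t => Complex.exp (-1 * ∑ j, (t j : ℂ) ^ 2 +
        ∑ j, (Complex.I * (star (w j) - z j)) * t j)) (fun s t => by
        rw [mul_assoc, ← kernel_mul_star_kernel, coderivIntegrand, cderiv_kernel, cderiv_kernel]
        simp only [Pi.smul_apply, smul_eq_mul, star_mul', star_prod, star_pow, star_star]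
        ring)
    rw [GaussianFourier.integral_cexp_neg_mul_sum_add (by simp), Fintype.card_fin, div_one] at h
    have h2 : (∑ j, (Complex.I * (star (w j) - z j)) ^ 2) / (4 * 1) =
        -∑ j, (star (w j) - z j) ^ 2 / 4 := by
      rw [mul_one, Finset.sum_div, ← Finset.sum_neg_distrib]
      refine Finset.sum_congr rfl fun j _ => ?_
      rw [mul_pow, Complex.I_sq]
      ring
    have h3 : ϱ.integral (fun s => ((∏ j, star (w j) ^ α j) * ∏ j, z j ^ β j) *
        Complex.exp (-∑ j, (s j : ℂ) ^ 2 + ∑ j, (star (w j) + z j) * s j)) =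
        ((∏ j, star (w j) ^ α j) * ∏ j, z j ^ β j) * J := by
      simp only [J, ComplexRadonMeasure.integral]
      rw [← integral_const_mul]
      simp only [mul_assoc]
    rw [coderivForm, h, h2, h3]
    ring
  have hpi : ((Real.pi : ℂ) ^ n)⁻¹ * (Real.pi : ℂ) ^ ((n : ℂ) / 2) =
      ((Real.pi ^ (-(n : ℝ) / 2) : ℝ) : ℂ) := by
    have h0 : (Real.pi : ℂ) ≠ 0 := by simp [Real.pi_ne_zero]
    rw [Complex.ofReal_cpow Real.pi_pos.le, ← Complex.cpow_natCast, ← Complex.cpow_neg,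
      ← Complex.cpow_add _ _ h0]
    congr 1
    push_cast
    ring
  rw [realCoderivForm]
  simp only [hform, ← mul_assoc]
  simp only [← Finset.sum_mul]
  have hs := sum_choose_mul_pow m (fun j => star (w j)) z
  simp only [← mul_assoc] at hs
  rw [hs]
  linear_combination (∏ j, (star (w j) + z j) ^ m j) * J *
    Complex.exp (-∑ j, (star (w j) - z j) ^ 2 / 4) * hpi

/-- Finiteness of `∫ |K_z|² e^{-|w|²} d|μ|` for a horizontal measure `μ` is a condition on `ϱ`
alone, since the integral over the imaginary directions is an ordinary Gaussian integral. -/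
theorem hasGaussianMoments_of_kernel {n : ℕ} {ϱ : ComplexRadonMeasure (Fin n → ℝ)}
    (h : ∀ z : Fin n → ℂ, Integrable (fun w => ‖kernel z w‖ ^ 2 * Real.exp (-sqNorm w))
      (horizontal ϱ).variation) : HasGaussianMoments ϱ := by
  intro c
  have := ϱ.isLocallyFinite
  have hE : MeasurableEmbedding (toComplexHomeo n) := (toComplexHomeo n).measurableEmbedding
  -- For `z = c / 2` real, `|K_z(s + it)|² e^{-|s + it|²} = e^{c·s - s²} e^{-t²}`.
  have h1 : Integrable ((fun w => ‖kernel (fun j => ((c j / 2 : ℝ) : ℂ)) w‖ ^ 2 *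
      Real.exp (-sqNorm w)) ∘ toComplexHomeo n) (ϱ.variation.prod volume) :=
    hE.integrable_map_iff.1 (h _)
  have h2 : ∀ s t : Fin n → ℝ, ‖kernel (fun j => ((c j / 2 : ℝ) : ℂ)) (toComplexHomeo n (s, t))‖ ^ 2 *
      Real.exp (-sqNorm (toComplexHomeo n (s, t))) =
      Real.exp (-∑ j, s j ^ 2 + ∑ j, c j * s j) * Real.exp (-∑ j, t j ^ 2) := fun s t => by
    rw [norm_kernel, sqNorm_toComplexHomeo, ← Real.exp_nat_mul, ← Real.exp_add, ← Real.exp_add]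
    congr 1
    have : (∑ j, star ((c j / 2 : ℝ) : ℂ) * toComplexHomeo n (s, t) j).re =
        (∑ j, c j * s j) / 2 := by
      rw [Complex.re_sum, Finset.sum_div]
      refine Finset.sum_congr rfl fun j _ => ?_
      rw [toComplexHomeo_apply]
      simp
      ring
    rw [this]
    push_cast
    ring
  obtain ⟨t, ht⟩ := h1.prod_left_ae.exists
  simp only [Function.comp_apply, h2] at ht
  refine (ht.mul_const (Real.exp (-∑ j, t j ^ 2))⁻¹).congr (Eventually.of_forall fun s => ?_)
  simp only
  rw [mul_assoc, mul_inv_cancel₀ (Real.exp_ne_zero _), mul_one]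

/-- A bounded operator with the matrix elements of the form in the reproducing kernels is
diagonalized by the Bargmann transform. -/
theorem isDiagonalizedBy_of_kernel {n : ℕ} {ϱ : ComplexRadonMeasure (Fin n → ℝ)}
    (hϱ : HasGaussianMoments ϱ) (m : Fin n → ℕ) (T : Fock n →L[ℂ] Fock n)
    (hT : ∀ w z, entire (T (kernelFock w)) z =
      realCoderivForm (horizontal ϱ) m (kernel w) (kernel z)) :
    IsDiagonalizedBy (bargmann n) T (gammaFn ϱ m) := by
  set e := (bargmann n).toContinuousLinearEquiv
  refine eq_mul_of_coherentLp (stronglyMeasurable_gammaFn ϱ m).aestronglyMeasurable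
    (e.toContinuousLinearMap ∘L T ∘L e.symm.toContinuousLinearMap) fun a => ?_
  have hS : (e.toContinuousLinearMap ∘L T ∘L e.symm.toContinuousLinearMap) (coherentLp a) =
      bargmann n (T (kernelFock (star a))) := by
    have : (bargmann n).symm (coherentLp a) = kernelFock (star a) := by
      rw [LinearIsometryEquiv.symm_apply_eq, bargmann_kernelFock, star_star]
    rw [← this]
    rfl
  rw [hS]
  set φ := bargmann n (T (kernelFock (star a)))
  have hi1 : ∀ b, Integrable fun x => φ x * coherent b x := fun b =>
    (Lp.memLp φ).integrable_mul (memLp_coherent b)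
  have hi2 := integrable_gammaFn_mul_coherent hϱ m a
  have hz : (fun x => φ x - gammaFn ϱ m x * coherent a x) =ᵐ[volume] 0 := by
    refine ae_eq_zero_of_coherent ?_ fun b => ?_
    · simp only [sub_mul]
      exact (hi1 0).sub (hi2 0)
    · simp only [sub_mul]
      rw [integral_sub (hi1 b) (hi2 b), ← entire_eq_integral_bargmann, hT,
        realCoderivForm_kernel, integral_gammaFn_mul_coherent hϱ]
      simp
  filter_upwards [hz] with x hx
  exact sub_eq_zero.1 hx

/-! ### Local estimates for derivatives of entire functions -/

theorem sqNorm_add_single_le {n : ℕ} (z : Fin n → ℂ) (j : Fin n) {ζ : ℂ}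
    (hζ : ‖ζ‖ * (1 + ‖z j‖) ≤ 1) : sqNorm (z + ζ • Pi.single j 1) ≤ sqNorm z + 3 := by
  have h1 : (∑ i, star (z i) * (ζ • (Pi.single j 1 : Fin n → ℂ)) i) = star (z j) * ζ := by
    rw [Finset.sum_eq_single j (fun i _ hi => by simp [Pi.single_eq_of_ne hi]) (by simp)]
    simp
  have h2 : sqNorm (ζ • (Pi.single j 1 : Fin n → ℂ)) = ‖ζ‖ ^ 2 := by
    rw [sqNorm, Finset.sum_eq_single j (fun i _ hi => by simp [Pi.single_eq_of_ne hi]) (by simp)]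
    simp
  have h3 : (star (z j) * ζ).re ≤ ‖z j‖ * ‖ζ‖ := by
    refine (Complex.re_le_norm _).trans ?_
    rw [norm_mul, norm_star]
  rw [sqNorm_add, h1, h2]
  nlinarith [norm_nonneg ζ, norm_nonneg (z j), mul_nonneg (norm_nonneg ζ) (norm_nonneg (z j))]

/-- Each derivative costs a factor `1 + |zⱼ|` in the weighted sup norm
`sup |f(w)| e^{-|w|²/2}` over a polydisk. A single derivative is estimated by Cauchy's inequality on
a circle of radius comparable to `1 / (1 + |zⱼ|)`, on which the Gaussian weight is comparable to its
value at the centre. -/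
theorem exists_norm_cderiv_le {n : ℕ} (α : Fin n → ℕ) {ε : ℝ} (hε : 0 < ε) :
    ∃ C : ℝ, 0 ≤ C ∧ ∀ f, Differentiable ℂ f → ∀ (z : Fin n → ℂ) (M : ℝ),
      (∀ w, (∀ j, ‖w j - z j‖ ≤ ε) → ‖f w‖ * Real.exp (-sqNorm w / 2) ≤ M) →
      ‖cderiv α f z‖ * Real.exp (-sqNorm z / 2) ≤ C * (∏ j, (1 + ‖z j‖) ^ α j) * M := by
  refine (cderiv_induction (P := fun a A => (∀ f, Differentiable ℂ f → Differentiable ℂ (A f)) ∧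
    ∀ ε : ℝ, 0 < ε → ∃ C : ℝ, 0 ≤ C ∧ ∀ f, Differentiable ℂ f → ∀ (z : Fin n → ℂ) (M : ℝ),
      (∀ w, (∀ j, ‖w j - z j‖ ≤ ε) → ‖f w‖ * Real.exp (-sqNorm w / 2) ≤ M) →
      ‖A f z‖ * Real.exp (-sqNorm z / 2) ≤ C * (∏ j, (1 + ‖z j‖) ^ a j) * M)
    ⟨fun _ h => h, fun ε hε => ⟨1, zero_le_one, fun f _ z M h => ?_⟩⟩
    (fun a A j ⟨hd, hA⟩ => ⟨fun f hf => differentiable_partialDeriv j (hd f hf),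
      fun ε hε => ?_⟩) α).2 ε hε
  · simpa using h z (by simp [hε.le])
  obtain ⟨C, hC0, hC⟩ := hA (ε / 2) (by positivity)
  -- Half of the radius is left to `A`; the cap `1` keeps the Gaussian weight under control.
  set δ := min (ε / 2) 1
  have hδ : 0 < δ := lt_min (by positivity) one_pos
  refine ⟨C * (∏ j, 2 ^ a j) * Real.exp (3 / 2) / δ, by positivity, fun f hf z M hM => ?_⟩
  have hM0 : 0 ≤ M := (by positivity : 0 ≤ ‖f z‖ * Real.exp (-sqNorm z / 2)).trans
    (hM z (by simp [hε.le]))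
  have hz : 0 < 1 + ‖z j‖ := by positivity
  set r := δ / (1 + ‖z j‖)
  have hr : 0 < r := by positivity
  have hrδ : r ≤ δ := div_le_self hδ.le (by linarith [norm_nonneg (z j)])
  set K := C * ((∏ i, 2 ^ a i) * ∏ i, (1 + ‖z i‖) ^ a i) * M
  have hK : 0 ≤ K := by positivity
  have hsph : ∀ ζ ∈ Metric.sphere (0 : ℂ) r, ‖A f (z + ζ • Pi.single j 1)‖ ≤
      K * Real.exp ((sqNorm z + 3) / 2) := fun ζ hζ => by
    have hζr : ‖ζ‖ = r := by simpa using hζ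
    set w : Fin n → ℂ := z + ζ • Pi.single j 1
    have hwz : ∀ i, ‖w i - z i‖ ≤ r := fun i => by
      have : w i - z i = ζ * (Pi.single j 1 : Fin n → ℂ) i := by simp [w]
      rw [this, norm_mul, hζr]
      refine mul_le_of_le_one_right hr.le ?_
      rcases eq_or_ne i j with rfl | hij
      · simp
      · simp [Pi.single_eq_of_ne hij]
    have h1 := hC f hf w M fun v hv => hM v fun i => by
      have := norm_sub_le_norm_sub_add_norm_sub (v i) (w i) (z i)
      linarith [hv i, hwz i, min_le_left (ε / 2) 1]
    have h2 : ∏ i, (1 + ‖w i‖) ^ a i ≤ (∏ i, 2 ^ a i) * ∏ i, (1 + ‖z i‖) ^ a i := by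
      rw [← Finset.prod_mul_distrib]
      refine Finset.prod_le_prod (fun i _ => by positivity) fun i _ => ?_
      rw [← mul_pow]
      gcongr
      have := norm_le_norm_add_norm_sub' (w i) (z i)
      linarith [hwz i, min_le_right (ε / 2) 1, norm_nonneg (z i)]
    have h3 : ‖A f w‖ * Real.exp (-sqNorm w / 2) ≤ K :=
      h1.trans (mul_le_mul_of_nonneg_right (mul_le_mul_of_nonneg_left h2 hC0) hM0)
    have h4 : sqNorm w ≤ sqNorm z + 3 := by
      refine sqNorm_add_single_le z j ?_
      rw [hζr, div_mul_cancel₀ _ hz.ne']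
      exact min_le_right _ _
    calc ‖A f w‖ = ‖A f w‖ * Real.exp (-sqNorm w / 2) * Real.exp (sqNorm w / 2) := by
          rw [mul_assoc, ← Real.exp_add]
          simp [neg_div]
      _ ≤ K * Real.exp ((sqNorm z + 3) / 2) := by gcongr
  have hcauchy := Complex.norm_deriv_le_of_forall_mem_sphere_norm_le hr
    (differentiable_line (hd f hf) z (Pi.single j 1)).diffContOnCl hsph
  rw [← partialDeriv_eq_deriv] at hcauchy
  have hprod : ∏ i, (1 + ‖z i‖) ^ (a + Pi.single j 1 : Fin n → ℕ) i =
      (∏ i, (1 + ‖z i‖) ^ a i) * (1 + ‖z j‖) := by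
    simp only [Pi.add_apply, pow_add, Finset.prod_mul_distrib]
    congr 1
    rw [Finset.prod_eq_single j (fun i _ hi => by simp [Pi.single_eq_of_ne hi]) (by simp)]
    simp
  calc ‖partialDeriv j (A f) z‖ * Real.exp (-sqNorm z / 2)
      ≤ K * Real.exp ((sqNorm z + 3) / 2) / r * Real.exp (-sqNorm z / 2) := by gcongr
    _ = K * (Real.exp ((sqNorm z + 3) / 2) * Real.exp (-sqNorm z / 2)) / r := by ring
    _ = K * Real.exp (3 / 2) / r := by
        rw [← Real.exp_add]
        congr 3
        ring
    _ = _ := by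
        rw [hprod]
        simp only [K, r]
        field_simp

theorem measurableSet_polydisk {n : ℕ} (z : Fin n → ℂ) (r : ℝ) :
    MeasurableSet {w : Fin n → ℂ | ∀ j, ‖w j - z j‖ < r} := by
  simp only [Set.ofPred_forall]
  exact MeasurableSet.iInter fun j => measurableSet_lt (by fun_prop) measurable_const

/-- The mean of `|f|²` over a polydisk. The Gaussian weight does no harm: it is the squared modulus of
`e^{-w̄ · u}`, up to factors that are invariant under rotations about the centre `w`. -/
theorem sq_norm_mul_exp_le {n : ℕ} {f : (Fin n → ℂ) → ℂ} (hf : Differentiable ℂ f)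
    (w : Fin n → ℂ) :
    gauss n {u | ∀ j, ‖u j - (0 : Fin n → ℂ) j‖ < 1 / 2} *
        (‖f w‖ₑ ^ 2 * ENNReal.ofReal (Real.exp (-sqNorm w))) ≤
      ∫⁻ v in {v | ∀ j, ‖v j - w j‖ < 1 / 2}, ‖f v‖ₑ ^ 2 ∂gauss n := by
  set P : Set (Fin n → ℂ) := {u | ∀ j, ‖u j - (0 : Fin n → ℂ) j‖ < 1 / 2}
  have hP : MeasurableSet P := measurableSet_polydisk 0 (1 / 2)
  set h : (Fin n → ℂ) → ℂ := fun u => f (u + w) * kernel (-w) u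
  have hd : Differentiable ℂ h := (hf.comp (by fun_prop)).mul (differentiable_kernel _)
  have hinv : ∀ θ : ℝ, MeasurePreserving (fun u : Fin n → ℂ => circleMap 0 1 θ • u)
      ((gauss n).restrict P) ((gauss n).restrict P) := fun θ => by
    have h1 := (measurePreserving_rotation_gauss θ).restrict_preimage hP
    have h2 : (fun u : Fin n → ℂ => circleMap 0 1 θ • u) ⁻¹' P = P := by
      ext u
      simp [P]
    rwa [h2] at h1
  have hint : Integrable (fun u => h u ^ 2) ((gauss n).restrict P) := by
    refine IntegrableOn.mono_set (t := Metric.closedBall 0 1)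
      ((hd.continuous.pow 2).continuousOn.integrableOn_compact (isCompact_closedBall 0 1))
      fun u hu => ?_
    rw [mem_closedBall_zero_iff, pi_norm_le_iff_of_nonneg zero_le_one]
    intro j
    have := hu j
    simp only [Pi.zero_apply, sub_zero] at this
    linarith
  have hmean := integral_eq_of_rotation_invariant hinv (hd.pow 2) hint
  have h0 : h 0 = f w := by simp [h, kernel]
  have hle : gauss n P * ‖f w‖ₑ ^ 2 ≤ ∫⁻ u in P, ‖h u‖ₑ ^ 2 ∂gauss n := by
    have h1 := enorm_integral_le_lintegral_enorm (μ := (gauss n).restrict P) (fun u => h u ^ 2)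
    simp only [enorm_pow] at h1
    refine le_trans (le_of_eq ?_) h1
    have h2 : ∫ u in P, h u ^ 2 ∂gauss n = (gauss n).real P * f w ^ 2 := by
      simpa [h0] using hmean
    rw [h2, enorm_mul, enorm_pow]
    congr 1
    rw [← ofReal_norm, Complex.norm_real, Real.norm_of_nonneg measureReal_nonneg,
      ofReal_measureReal]
  have hshift : (∫⁻ u in P, ‖h u‖ₑ ^ 2 ∂gauss n) * ENNReal.ofReal (Real.exp (-sqNorm w)) =
      ∫⁻ v in {v | ∀ j, ‖v j - w j‖ < 1 / 2}, ‖f v‖ₑ ^ 2 ∂gauss n := by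
    have hQ := measurableSet_polydisk w (1 / 2)
    have hm1 : Measurable fun u => ‖h u‖ₑ ^ 2 := (hd.continuous.measurable.enorm).pow_const 2
    have hm2 : Measurable fun u => ‖f u‖ₑ ^ 2 := (hf.continuous.measurable.enorm).pow_const 2
    rw [← lintegral_indicator hP, ← lintegral_indicator hQ, gauss,
      lintegral_withDensity_eq_lintegral_mul _ measurable_gauss_density (hm1.indicator hP),
      lintegral_withDensity_eq_lintegral_mul _ measurable_gauss_density (hm2.indicator hQ),
      ← lintegral_mul_const' _ _ ENNReal.ofReal_ne_top]
    refine Eq.trans (lintegral_congr fun u => ?_) (lintegral_add_right_eq_self _ w)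
    simp only [Pi.mul_apply]
    by_cases hu : u ∈ P
    · have hu' : u + w ∈ {v | ∀ j, ‖v j - w j‖ < 1 / 2} := fun j => by simpa [P] using hu j
      rw [Set.indicator_of_mem hu, Set.indicator_of_mem hu']
      have hreal : (Real.pi ^ n)⁻¹ * Real.exp (-sqNorm u) * ‖h u‖ ^ 2 * Real.exp (-sqNorm w) =
          (Real.pi ^ n)⁻¹ * Real.exp (-sqNorm (u + w)) * ‖f (u + w)‖ ^ 2 := by
        have he : Real.exp (-sqNorm u) * ‖kernel (-w) u‖ ^ 2 * Real.exp (-sqNorm w) =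
            Real.exp (-sqNorm (u + w)) := by
          rw [mul_comm (Real.exp _), norm_kernel_mul_exp, sub_neg_eq_add, mul_right_comm,
            ← Real.exp_add]
          have : sqNorm (-w) = sqNorm w := by simp [sqNorm]
          simp [this]
        simp only [h, norm_mul, mul_pow]
        linear_combination (Real.pi ^ n)⁻¹ * ‖f (u + w)‖ ^ 2 * he
      rw [← ofReal_norm, ← ofReal_norm, ← ENNReal.ofReal_pow (norm_nonneg _),
        ← ENNReal.ofReal_pow (norm_nonneg _), ← ENNReal.ofReal_mul (gauss_density_pos _).le,
        ← ENNReal.ofReal_mul (by have := gauss_density_pos u; positivity),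
        ← ENNReal.ofReal_mul (gauss_density_pos _).le, hreal]
    · have hu' : u + w ∉ {v | ∀ j, ‖v j - w j‖ < 1 / 2} := fun h => hu fun j => by simpa using h j
      rw [Set.indicator_of_notMem hu, Set.indicator_of_notMem hu']
      simp
  rw [← hshift, ← mul_assoc]
  gcongr

theorem gauss_polydisk_ne_zero {n : ℕ} :
    gauss n {u | ∀ j, ‖u j - (0 : Fin n → ℂ) j‖ < 1 / 2} ≠ 0 := by
  refine (IsOpen.measure_pos (gauss n) ?_ ⟨0, by simp⟩).ne'
  simp only [Set.ofPred_forall]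
  exact isOpen_iInter_of_finite fun j => isOpen_lt (by fun_prop) continuous_const

/-- The integral of `|f|²` over the polydisk of radius `1`. -/
def localSq {n : ℕ} (f : (Fin n → ℂ) → ℂ) (z : Fin n → ℂ) : ENNReal :=
  ∫⁻ v in {w | ∀ j, ‖w j - z j‖ < 1}, ‖f v‖ₑ ^ 2 ∂gauss n

theorem exists_sq_norm_le_localSq (n : ℕ) : ∃ C : ENNReal, C ≠ ⊤ ∧
    ∀ f : (Fin n → ℂ) → ℂ, Differentiable ℂ f → ∀ z w : Fin n → ℂ, (∀ j, ‖w j - z j‖ ≤ 1 / 2) →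
      ‖f w‖ₑ ^ 2 * ENNReal.ofReal (Real.exp (-sqNorm w)) ≤ C * localSq f z := by
  refine ⟨(gauss n {u | ∀ j, ‖u j - (0 : Fin n → ℂ) j‖ < 1 / 2})⁻¹,
    ENNReal.inv_ne_top.2 gauss_polydisk_ne_zero, fun f hf z w hw => ?_⟩
  rw [← ENNReal.mul_le_iff_le_inv gauss_polydisk_ne_zero (measure_ne_top _ _)]
  refine (sq_norm_mul_exp_le hf w).trans (lintegral_mono_set fun v hv j => ?_)
  have := norm_sub_le_norm_sub_add_norm_sub (v j) (w j) (z j)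
  linarith [hv j, hw j]

/-- The local `L₂` bound for derivatives. -/
theorem exists_enorm_cderiv_le {n : ℕ} (α : Fin n → ℕ) : ∃ C : ENNReal, C ≠ ⊤ ∧
    ∀ f : (Fin n → ℂ) → ℂ, Differentiable ℂ f → MemLp f 2 (gauss n) → ∀ z : Fin n → ℂ,
      ‖cderiv α f z‖ₑ * ENNReal.ofReal (Real.exp (-sqNorm z / 2)) ≤
        C * ENNReal.ofReal (∏ j, (1 + ‖z j‖) ^ α j) * localSq f z ^ (1 / 2 : ℝ) := by
  obtain ⟨C, hC0, hC⟩ := exists_norm_cderiv_le α (ε := 1 / 2) (by norm_num)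
  obtain ⟨D, hD, hDle⟩ := exists_sq_norm_le_localSq n
  refine ⟨ENNReal.ofReal C * D ^ (1 / 2 : ℝ), ENNReal.mul_ne_top ENNReal.ofReal_ne_top
    (ENNReal.rpow_ne_top_of_nonneg (by norm_num) hD), fun f hf hm z => ?_⟩
  have hfin : localSq f z ≠ ⊤ := by
    have h := lintegral_rpow_enorm_lt_top_of_eLpNorm_lt_top two_ne_zero ENNReal.ofNat_ne_top hm.2
    simp only [ENNReal.toReal_ofNat, ENNReal.rpow_ofNat] at h
    exact ((setLIntegral_le_lintegral _ _).trans_lt h).ne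
  set L := (D * localSq f z) ^ (1 / 2 : ℝ)
  have hL : L ≠ ⊤ := ENNReal.rpow_ne_top_of_nonneg (by norm_num) (ENNReal.mul_ne_top hD hfin)
  have h1 := hC f hf z L.toReal fun w hw => by
    have h2 := hDle f hf z w hw
    have h3 : ‖f w‖ₑ ^ 2 * ENNReal.ofReal (Real.exp (-sqNorm w)) =
        (ENNReal.ofReal (‖f w‖ * Real.exp (-sqNorm w / 2))) ^ 2 := by
      rw [ENNReal.ofReal_mul (norm_nonneg _), mul_pow, ofReal_norm,
        ← ENNReal.ofReal_pow (Real.exp_nonneg _), ← Real.exp_nat_mul]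
      congr 3
      push_cast
      ring
    rw [h3, ← ENNReal.rpow_two] at h2
    rw [← ENNReal.ofReal_le_iff_le_toReal hL]
    have h4 := ENNReal.rpow_le_rpow h2 (show (0 : ℝ) ≤ 1 / 2 by norm_num)
    rw [← ENNReal.rpow_mul] at h4
    simpa [L] using h4
  have h5 := ENNReal.ofReal_le_ofReal h1
  rw [ENNReal.ofReal_mul (norm_nonneg _), ofReal_norm, ENNReal.ofReal_mul (by positivity),
    ENNReal.ofReal_mul hC0, ENNReal.ofReal_toReal hL] at h5
  refine h5.trans (le_of_eq ?_)
  simp only [L]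
  rw [ENNReal.mul_rpow_of_nonneg _ _ (by norm_num)]
  ring

/-! ### Fock-Carleson measures and the Toeplitz operator -/

/-- The integrand of `localSq`, as a function of both variables. -/
def localSqKernel {n : ℕ} (f : (Fin n → ℂ) → ℂ) (z v : Fin n → ℂ) : ENNReal :=
  {w : Fin n → ℂ | ∀ j, ‖w j - z j‖ < 1}.indicator (fun v => ‖f v‖ₑ ^ 2) v

theorem localSq_eq {n : ℕ} (f : (Fin n → ℂ) → ℂ) (z : Fin n → ℂ) :
    localSq f z = ∫⁻ v, localSqKernel f z v ∂gauss n :=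
  (lintegral_indicator (measurableSet_polydisk z 1) _).symm

theorem measurable_localSqKernel {n : ℕ} {f : (Fin n → ℂ) → ℂ} (hf : Differentiable ℂ f) :
    Measurable (Function.uncurry (localSqKernel f)) := by
  have hS : MeasurableSet {p : (Fin n → ℂ) × (Fin n → ℂ) | ∀ j, ‖p.2 j - p.1 j‖ < 1} := by
    simp only [Set.ofPred_forall]
    exact MeasurableSet.iInter fun j => measurableSet_lt (by fun_prop) measurable_const
  exact (((hf.continuous.measurable.comp measurable_snd).enorm).pow_const 2).indicator hS

theorem measurable_localSq {n : ℕ} {f : (Fin n → ℂ) → ℂ} (hf : Differentiable ℂ f) :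
    Measurable (localSq f) := by
  rw [show localSq f = _ from funext (localSq_eq f)]
  exact (measurable_localSqKernel hf).lintegral_prod_right'

/-- Tonelli's theorem turns a uniform bound for the measure of the unit polydisks into a bound for
the integral of the local means. -/
theorem lintegral_localSq_le {n : ℕ} (ν : Measure (Fin n → ℂ)) [SFinite ν]
    {f : (Fin n → ℂ) → ℂ} (hf : Differentiable ℂ f) :
    ∫⁻ z, localSq f z ∂ν ≤
      (⨆ z : Fin n → ℂ, ν {w | ∀ j, ‖w j - z j‖ < 1}) * ∫⁻ v, ‖f v‖ₑ ^ 2 ∂gauss n := by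
  simp only [localSq_eq]
  rw [lintegral_lintegral_swap (measurable_localSqKernel hf).aemeasurable,
    ← lintegral_const_mul _ ((hf.continuous.measurable.enorm).pow_const 2)]
  refine lintegral_mono fun v => ?_
  have h2 : ∀ z, localSqKernel f z v =
      {w | ∀ j, ‖w j - v j‖ < 1}.indicator (fun _ => ‖f v‖ₑ ^ 2) z := fun z => by
    simp only [localSqKernel, Set.indicator_apply, Set.mem_ofPred_eq, norm_sub_rev]
  simp only [h2]
  rw [lintegral_indicator (measurableSet_polydisk v 1), setLIntegral_const, mul_comm]
  gcongr
  exact le_iSup (fun z : Fin n → ℂ => ν {w | ∀ j, ‖w j - z j‖ < 1}) v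

theorem lintegral_sq_entire {n : ℕ} (f : Fock n) :
    ∫⁻ v, ‖entire f v‖ₑ ^ 2 ∂gauss n = ENNReal.ofReal ‖f‖ ^ 2 := by
  have h := eLpNorm_nnreal_pow_eq_lintegral (p := 2) (f := entire f) (μ := gauss n) (by norm_num)
  simp only [NNReal.coe_ofNat, ENNReal.rpow_ofNat, ENNReal.coe_ofNat] at h
  rw [← h, ← eLpNorm_congr_ae (coe_ae_eq_entire f), Submodule.coe_norm, Lp.norm_def,
    ENNReal.ofReal_toReal (Lp.eLpNorm_ne_top _)]

theorem measurable_weight {n : ℕ} (k : Fin n → ℝ) : Measurable fun z : Fin n → ℂ =>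
    ENNReal.ofReal (∏ j, (1 + (z j).re ^ 2) ^ k j * (1 + (z j).im ^ 2) ^ k j) := by
  refine (Finset.measurable_fun_prod _ fun j _ => ?_).ennreal_ofReal
  have h1 : Measurable fun z : Fin n → ℂ => (z j).re :=
    Complex.measurable_re.comp (measurable_pi_apply j)
  have h2 : Measurable fun z : Fin n → ℂ => (z j).im :=
    Complex.measurable_im.comp (measurable_pi_apply j)
  fun_prop

theorem sFinite_weightedVariation {n : ℕ} (k : Fin n → ℝ)
    (μ : ComplexRadonMeasure (Fin n → ℂ)) : SFinite (weightedVariation k μ) := by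
  have := μ.isLocallyFinite
  unfold weightedVariation
  infer_instance

theorem one_le_weight {n : ℕ} {k : Fin n → ℝ} (hk : ∀ j, 0 ≤ k j) (z : Fin n → ℂ) :
    1 ≤ ∏ j, (1 + (z j).re ^ 2) ^ k j * (1 + (z j).im ^ 2) ^ k j := by
  refine Finset.one_le_prod fun j _ => one_le_mul_of_one_le_of_one_le ?_ ?_
  all_goals exact Real.one_le_rpow (by nlinarith [sq_nonneg (z j).re, sq_nonneg (z j).im]) (hk j)

theorem prod_pow_le_weight {n : ℕ} {k : Fin n → ℝ} {m : Fin n → ℕ}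
    (hm : ∀ j, (m j : ℝ) = 2 * k j) (z : Fin n → ℂ) :
    ∏ j, (1 + ‖z j‖) ^ m j ≤
      (∏ j, (2 : ℝ) ^ k j) * ∏ j, (1 + (z j).re ^ 2) ^ k j * (1 + (z j).im ^ 2) ^ k j := by
  rw [← Finset.prod_mul_distrib]
  refine Finset.prod_le_prod (fun j _ => by positivity) fun j _ => ?_
  have hk : 0 ≤ k j := by
    have : (0 : ℝ) ≤ m j := Nat.cast_nonneg _
    linarith [hm j]
  rw [← Real.rpow_natCast, hm j, Real.rpow_mul (by positivity),
    ← Real.mul_rpow (by positivity) (by positivity), ← Real.mul_rpow (by positivity) (by positivity)]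
  refine Real.rpow_le_rpow (by positivity) ?_ hk
  have h1 : ‖z j‖ ^ 2 = (z j).re ^ 2 + (z j).im ^ 2 := by
    rw [Complex.sq_norm, Complex.normSq_apply]
    ring
  rw [Real.rpow_two]
  nlinarith [sq_nonneg (‖z j‖ - 1), mul_nonneg (sq_nonneg (z j).re) (sq_nonneg (z j).im)]

theorem nonneg_of_cast_eq_two_mul {n : ℕ} {k : Fin n → ℝ} {m : Fin n → ℕ}
    (hm : ∀ j, (m j : ℝ) = 2 * k j) (j : Fin n) : 0 ≤ k j := by
  have : (0 : ℝ) ≤ m j := Nat.cast_nonneg _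
  linarith [hm j]

theorem IsKFC.iSup_ne_top {n : ℕ} {k : Fin n → ℝ} (hk : ∀ j, 0 ≤ k j)
    {μ : ComplexRadonMeasure (Fin n → ℂ)} (h : IsKFC k μ) :
    (⨆ z : Fin n → ℂ, weightedVariation k μ {w | ∀ j, ‖w j - z j‖ < 1}) ≠ ⊤ := by
  have hpos : 0 < (∏ j, Real.Gamma (k j + 1)) ^ 2 :=
    pow_pos (Finset.prod_pos fun j _ => Real.Gamma_pos_of_pos (by linarith [hk j])) 2
  rcases ENNReal.mul_lt_top_iff.1 h with h1 | h1 | h1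
  · exact h1.2.ne
  · exact absurd h1 (ENNReal.ofReal_pos.2 hpos).ne'
  · rw [h1]
    exact ENNReal.zero_ne_top

/-- `f ∈ L₂(e^{-|z|²} d|μ|)` for `f` in the Fock space. -/
theorem IsKFC.integrable_sq {n : ℕ} {k : Fin n → ℝ} (hk : ∀ j, 0 ≤ k j)
    {μ : ComplexRadonMeasure (Fin n → ℂ)} (h : IsKFC k μ) (f : Fock n) :
    Integrable (fun w => ‖entire f w‖ ^ 2 * Real.exp (-sqNorm w)) μ.variation := by
  have hf := differentiable_entire f
  have := sFinite_weightedVariation k μ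
  obtain ⟨C, hC, hle⟩ := exists_sq_norm_le_localSq n
  have hc : Continuous fun w => ‖entire f w‖ ^ 2 * Real.exp (-sqNorm w) :=
    (hf.continuous.norm.pow 2).mul (Real.continuous_exp.comp continuous_sqNorm.neg)
  refine ⟨hc.aestronglyMeasurable, ?_⟩
  have h1 : ∀ w, ‖‖entire f w‖ ^ 2 * Real.exp (-sqNorm w)‖ₑ ≤ C * (ENNReal.ofReal
      (∏ j, (1 + (w j).re ^ 2) ^ k j * (1 + (w j).im ^ 2) ^ k j) * localSq (entire f) w) :=
      fun w => by
    rw [← ofReal_norm, Real.norm_of_nonneg (by positivity), ENNReal.ofReal_mul (by positivity),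
      ENNReal.ofReal_pow (norm_nonneg _), ofReal_norm]
    refine (hle _ hf w w (by simp)).trans ?_
    gcongr
    refine le_mul_of_one_le_left zero_le ?_
    rw [ENNReal.one_le_ofReal]
    exact one_le_weight hk w
  refine (lintegral_mono h1).trans_lt ?_
  rw [lintegral_const_mul' _ _ hC]
  refine ENNReal.mul_lt_top hC.lt_top ?_
  have h2 := lintegral_withDensity_eq_lintegral_mul μ.variation (measurable_weight k)
    (measurable_localSq hf)
  simp only [Pi.mul_apply] at h2
  rw [← h2]
  refine (lintegral_localSq_le (weightedVariation k μ) hf).trans_lt ?_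
  rw [lintegral_sq_entire]
  exact ENNReal.mul_lt_top (h.iSup_ne_top hk).lt_top (ENNReal.pow_lt_top ENNReal.ofReal_lt_top)

/-- The Fock-Carleson estimate for derivatives: the two local bounds together produce the weight
`∏ (1 + |zⱼ|)^{2kⱼ}`, which the condition on `μ` absorbs. -/
theorem IsKFC.exists_lintegral_le {n : ℕ} {k : Fin n → ℝ} {m : Fin n → ℕ}
    (hm : ∀ j, (m j : ℝ) = 2 * k j) {μ : ComplexRadonMeasure (Fin n → ℂ)} (h : IsKFC k μ)
    {β : Fin n → ℕ} (hβ : β ≤ m) : ∃ C : ENNReal, C ≠ ⊤ ∧ ∀ f g : Fock n,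
      ∫⁻ z, ‖coderivIntegrand (m - β) β (entire f) (entire g) z‖ₑ ∂μ.variation ≤
        C * (ENNReal.ofReal ‖f‖ * ENNReal.ofReal ‖g‖) := by
  have hk := nonneg_of_cast_eq_two_mul hm
  have := sFinite_weightedVariation k μ
  obtain ⟨C, hC, hCle⟩ := exists_enorm_cderiv_le (m - β)
  obtain ⟨D, hD, hDle⟩ := exists_enorm_cderiv_le β
  set S := ⨆ z : Fin n → ℂ, weightedVariation k μ {w | ∀ j, ‖w j - z j‖ < 1}
  have hS : S ≠ ⊤ := h.iSup_ne_top hk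
  set E := ENNReal.ofReal (∏ j, (2 : ℝ) ^ k j)
  refine ⟨C * D * E * S, by finiteness, fun f g => ?_⟩
  have hf := differentiable_entire f
  have hg := differentiable_entire g
  have h1 : ∀ z, ‖coderivIntegrand (m - β) β (entire f) (entire g) z‖ₑ ≤ C * D * E *
      (ENNReal.ofReal (∏ j, (1 + (z j).re ^ 2) ^ k j * (1 + (z j).im ^ 2) ^ k j) *
        (localSq (entire f) z ^ (1 / 2 : ℝ) * localSq (entire g) z ^ (1 / 2 : ℝ))) := fun z => by
    have h2 : ‖coderivIntegrand (m - β) β (entire f) (entire g) z‖ₑ =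
        (‖cderiv (m - β) (entire f) z‖ₑ * ENNReal.ofReal (Real.exp (-sqNorm z / 2))) *
        (‖cderiv β (entire g) z‖ₑ * ENNReal.ofReal (Real.exp (-sqNorm z / 2))) := by
      rw [coderivIntegrand, enorm_mul, enorm_mul, mul_mul_mul_comm,
        ← ENNReal.ofReal_mul (Real.exp_nonneg _), ← Real.exp_add, add_halves]
      congr 1
      · congr 1
        rw [← ofReal_norm, norm_star, ofReal_norm]
      · rw [← ofReal_norm, Complex.norm_real, Real.norm_of_nonneg (Real.exp_nonneg _)]
    have h3 : ENNReal.ofReal (∏ j, (1 + ‖z j‖) ^ (m - β) j) *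
        ENNReal.ofReal (∏ j, (1 + ‖z j‖) ^ β j) ≤ E * ENNReal.ofReal
        (∏ j, (1 + (z j).re ^ 2) ^ k j * (1 + (z j).im ^ 2) ^ k j) := by
      rw [← ENNReal.ofReal_mul (by positivity), ← ENNReal.ofReal_mul (by positivity),
        ← Finset.prod_mul_distrib]
      refine ENNReal.ofReal_le_ofReal (le_trans (le_of_eq ?_) (prod_pow_le_weight hm z))
      refine Finset.prod_congr rfl fun j _ => ?_
      rw [← pow_add, Pi.sub_apply, Nat.sub_add_cancel (hβ j)]
    rw [h2]
    calc _ ≤ (C * ENNReal.ofReal (∏ j, (1 + ‖z j‖) ^ (m - β) j) *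
            localSq (entire f) z ^ (1 / 2 : ℝ)) *
          (D * ENNReal.ofReal (∏ j, (1 + ‖z j‖) ^ β j) * localSq (entire g) z ^ (1 / 2 : ℝ)) :=
          mul_le_mul' (hCle _ hf (memLp_entire f) z) (hDle _ hg (memLp_entire g) z)
      _ = C * D * ((ENNReal.ofReal (∏ j, (1 + ‖z j‖) ^ (m - β) j) *
          ENNReal.ofReal (∏ j, (1 + ‖z j‖) ^ β j)) *
          (localSq (entire f) z ^ (1 / 2 : ℝ) * localSq (entire g) z ^ (1 / 2 : ℝ))) := by ring
      _ ≤ C * D * ((E * ENNReal.ofReal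
          (∏ j, (1 + (z j).re ^ 2) ^ k j * (1 + (z j).im ^ 2) ^ k j)) *
          (localSq (entire f) z ^ (1 / 2 : ℝ) * localSq (entire g) z ^ (1 / 2 : ℝ))) := by gcongr
      _ = _ := by ring
  have hmf := measurable_localSq hf
  have hmg := measurable_localSq hg
  refine (lintegral_mono h1).trans ?_
  rw [lintegral_const_mul' _ _ (by finiteness)]
  have h4 := lintegral_withDensity_eq_lintegral_mul μ.variation (measurable_weight k)
    ((hmf.pow_const (1 / 2 : ℝ)).mul (hmg.pow_const (1 / 2 : ℝ)))
  simp only [Pi.mul_apply] at h4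
  rw [← h4, mul_assoc _ S]
  refine mul_le_mul_right ?_ _
  refine (ENNReal.lintegral_mul_le_Lp_mul_Lq (weightedVariation k μ) Real.HolderConjugate.two_two
    (hmf.pow_const _).aemeasurable (hmg.pow_const _).aemeasurable).trans ?_
  have h5 : ∀ f : Fock n, (∫⁻ z, (localSq (entire f) z ^ (1 / 2 : ℝ)) ^ (2 : ℝ)
      ∂weightedVariation k μ) ^ (1 / 2 : ℝ) ≤ S ^ (1 / 2 : ℝ) * ENNReal.ofReal ‖f‖ := fun f => by
    simp only [← ENNReal.rpow_mul]
    norm_num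
    refine (ENNReal.rpow_le_rpow (lintegral_localSq_le (weightedVariation k μ)
      (differentiable_entire f)) (by norm_num)).trans (le_of_eq ?_)
    rw [lintegral_sq_entire, ENNReal.mul_rpow_of_nonneg _ _ (by norm_num), ← ENNReal.rpow_two,
      ← ENNReal.rpow_mul]
    norm_num
    rfl
  refine (mul_le_mul' (h5 f) (h5 g)).trans (le_of_eq ?_)
  rw [mul_mul_mul_comm, ← ENNReal.rpow_add_of_nonneg _ _ (by norm_num) (by norm_num)]
  norm_num

theorem IsKFC.integrable_coderivIntegrand {n : ℕ} {k : Fin n → ℝ} {m : Fin n → ℕ}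
    (hm : ∀ j, (m j : ℝ) = 2 * k j) {μ : ComplexRadonMeasure (Fin n → ℂ)} (h : IsKFC k μ)
    {β : Fin n → ℕ} (hβ : β ≤ m) (f g : Fock n) :
    Integrable (coderivIntegrand (m - β) β (entire f) (entire g)) μ.variation := by
  obtain ⟨C, hC, hle⟩ := h.exists_lintegral_le hm hβ
  have h1 := (differentiable_cderiv (m - β) (differentiable_entire f)).continuous
  have h2 := (differentiable_cderiv β (differentiable_entire g)).continuous
  have hc : Continuous (coderivIntegrand (m - β) β (entire f) (entire g)) :=
    (h1.mul h2.star).mul (Complex.continuous_ofReal.comp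
      (Real.continuous_exp.comp continuous_sqNorm.neg))
  exact ⟨hc.aestronglyMeasurable, (hle f g).trans_lt (by finiteness)⟩

theorem integral_add_of_integrable {X : Type} [TopologicalSpace X] [MeasurableSpace X]
    (μ : ComplexRadonMeasure X) {f g : X → ℂ} (hf : Integrable f μ.variation)
    (hg : Integrable g μ.variation) : μ.integral (f + g) = μ.integral f + μ.integral g := by
  have h : ∀ f, Integrable f μ.variation → Integrable (fun x => f x * μ.phase x) μ.variation :=
    fun f hf => hf.mul_bdd (c := 1) μ.measurable_phase.aestronglyMeasurable
      (Eventually.of_forall fun x => (μ.norm_phase x).le)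
  simp only [ComplexRadonMeasure.integral, Pi.add_apply, add_mul]
  exact integral_add (h f hf) (h g hg)

theorem integral_smul_eq {X : Type} [TopologicalSpace X] [MeasurableSpace X]
    (μ : ComplexRadonMeasure X) (c : ℂ) (f : X → ℂ) : μ.integral (c • f) = c * μ.integral f := by
  simp only [ComplexRadonMeasure.integral, Pi.smul_apply, smul_eq_mul, mul_assoc]
  exact integral_const_mul _ _

theorem enorm_integral_le {X : Type} [TopologicalSpace X] [MeasurableSpace X]
    (μ : ComplexRadonMeasure X) (f : X → ℂ) :
    ‖μ.integral f‖ₑ ≤ ∫⁻ x, ‖f x‖ₑ ∂μ.variation := by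
  refine (enorm_integral_le_lintegral_enorm _).trans (lintegral_mono fun x => ?_)
  rw [enorm_mul, ← ofReal_norm (μ.phase x), μ.norm_phase, ENNReal.ofReal_one, mul_one]

theorem IsKFC.exists_norm_realCoderivForm_le {n : ℕ} {k : Fin n → ℝ} {m : Fin n → ℕ}
    (hm : ∀ j, (m j : ℝ) = 2 * k j) {μ : ComplexRadonMeasure (Fin n → ℂ)} (h : IsKFC k μ) :
    ∃ C : ℝ, ∀ f g : Fock n, ‖realCoderivForm μ m (entire f) (entire g)‖ ≤ C * ‖f‖ * ‖g‖ := by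
  have h1 : ∀ β, β ≤ m → ∃ C : ℝ, ∀ f g : Fock n,
      ‖coderivForm μ (m - β) β (entire f) (entire g)‖ ≤ C * (‖f‖ * ‖g‖) := fun β hβ => by
    obtain ⟨C, hC, hle⟩ := h.exists_lintegral_le hm hβ
    refine ⟨‖((Real.pi : ℂ) ^ n)⁻¹‖ * C.toReal, fun f g => ?_⟩
    rw [coderivForm, norm_mul, mul_assoc]
    refine mul_le_mul_of_nonneg_left ?_ (norm_nonneg _)
    have h2 := (enorm_integral_le μ _).trans (hle f g)
    rw [← ENNReal.ofReal_mul (norm_nonneg _), ← ofReal_norm] at h2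
    have h3 := ENNReal.toReal_mono (by finiteness) h2
    rwa [ENNReal.toReal_ofReal (norm_nonneg _), ENNReal.toReal_mul,
      ENNReal.toReal_ofReal (by positivity)] at h3
  choose! C hC using h1
  refine ⟨∑ β ∈ Finset.Icc 0 m, ‖((∏ j, (m j).choose (β j) : ℕ) : ℂ)‖ * C β, fun f g => ?_⟩
  rw [realCoderivForm, mul_assoc, Finset.sum_mul]
  refine (norm_sum_le _ _).trans (Finset.sum_le_sum fun β hβ => ?_)
  rw [norm_mul, mul_assoc]
  exact mul_le_mul_of_nonneg_left (hC β (Finset.mem_Icc.1 hβ).2 f g) (norm_nonneg _)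

/-- The form of the real coderivative as a sesquilinear form on the Fock space, conjugate linear in
its first argument. -/
def IsKFC.sesqForm {n : ℕ} {k : Fin n → ℝ} {m : Fin n → ℕ} (hm : ∀ j, (m j : ℝ) = 2 * k j)
    {μ : ComplexRadonMeasure (Fin n → ℂ)} (h : IsKFC k μ) : Fock n →ₗ⋆[ℂ] Fock n →ₗ[ℂ] ℂ :=
  LinearMap.mk₂'ₛₗ (starRingEnd ℂ) (RingHom.id ℂ)
    (fun g f => realCoderivForm μ m (entire f) (entire g))
    (fun g g' f => by
      simp only [realCoderivForm, ← Finset.sum_add_distrib]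
      refine Finset.sum_congr rfl fun β hβ => ?_
      have hβ := (Finset.mem_Icc.1 hβ).2
      rw [coderivForm, coderivForm, coderivForm, ← mul_add, ← mul_add, ← integral_add_of_integrable
        μ (h.integrable_coderivIntegrand hm hβ f g) (h.integrable_coderivIntegrand hm hβ f g')]
      congr 3
      funext z
      simp only [coderivIntegrand, entire_add, cderiv_add β (differentiable_entire g)
        (differentiable_entire g'), Pi.add_apply, star_add]
      ring)
    (fun c g f => by
      simp only [realCoderivForm, smul_eq_mul, Finset.mul_sum]
      refine Finset.sum_congr rfl fun β _ => ?_
      have : coderivIntegrand (m - β) β (entire f) (entire (c • g)) =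
          starRingEnd ℂ c • coderivIntegrand (m - β) β (entire f) (entire g) := by
        funext z
        simp only [coderivIntegrand, entire_smul, cderiv_smul, Pi.smul_apply, smul_eq_mul,
          star_mul', starRingEnd_apply]
        ring
      rw [coderivForm, coderivForm, this, integral_smul_eq]
      ring)
    (fun g f f' => by
      simp only [realCoderivForm, ← Finset.sum_add_distrib]
      refine Finset.sum_congr rfl fun β hβ => ?_
      have hβ := (Finset.mem_Icc.1 hβ).2
      rw [coderivForm, coderivForm, coderivForm, ← mul_add, ← mul_add, ← integral_add_of_integrable
        μ (h.integrable_coderivIntegrand hm hβ f g) (h.integrable_coderivIntegrand hm hβ f' g)]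
      congr 3
      funext z
      simp only [coderivIntegrand, entire_add, cderiv_add (m - β) (differentiable_entire f)
        (differentiable_entire f'), Pi.add_apply]
      ring)
    (fun c g f => by
      simp only [realCoderivForm, smul_eq_mul, Finset.mul_sum, RingHom.id_apply]
      refine Finset.sum_congr rfl fun β _ => ?_
      have : coderivIntegrand (m - β) β (entire (c • f)) (entire g) =
          c • coderivIntegrand (m - β) β (entire f) (entire g) := by
        funext z
        simp only [coderivIntegrand, entire_smul, cderiv_smul, Pi.smul_apply, smul_eq_mul]
        ring
      rw [coderivForm, coderivForm, this, integral_smul_eq]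
      ring)

instance {n : ℕ} : CompleteSpace (Fock n) :=
  (completeSpace_congr (e := (bargmann n).toEquiv) (bargmann n).isometry.isUniformEmbedding).2
    inferInstance

/-- The bounded Toeplitz operator generated by the form, by the Riesz representation theorem. -/
theorem IsKFC.exists_toeplitz {n : ℕ} {k : Fin n → ℝ} {m : Fin n → ℕ}
    (hm : ∀ j, (m j : ℝ) = 2 * k j) {μ : ComplexRadonMeasure (Fin n → ℂ)} (h : IsKFC k μ) :
    ∃ T : Fock n →L[ℂ] Fock n, ∀ f g : Fock n,
      inner ℂ g (T f) = realCoderivForm μ m (entire f) (entire g) := by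
  obtain ⟨C, hC⟩ := h.exists_norm_realCoderivForm_le hm
  set A : Fock n →L⋆[ℂ] Fock n →L[ℂ] ℂ := (h.sesqForm hm).mkContinuous₂ C fun g f => by
    rw [mul_right_comm]
    exact hC f g
  refine ⟨(InnerProductSpace.continuousLinearMapOfBilin A).adjoint, fun f g => ?_⟩
  rw [ContinuousLinearMap.adjoint_inner_right,
    InnerProductSpace.continuousLinearMapOfBilin_apply]
  rfl

end FockToeplitz

end

theorem theorem5p2 (n : ℕ) :
    ∃ B : Fock n ≃ₗᵢ[ℂ] Lp ℂ 2 (volume : Measure (Fin n → ℝ)), IsBargmann B ∧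
    ∀ (k : Fin n → ℝ) (m : Fin n → ℕ), (∀ j, (m j : ℝ) = 2 * k j) →
    ∀ ϱ : ComplexRadonMeasure (Fin n → ℝ),
      -- the case of a Fock-Carleson measure of order `k`
      (IsKFC k (horizontal ϱ) →
        (∀ f g : Fock n, ∀ β ≤ m,
          Integrable (coderivIntegrand (m - β) β (entire f) (entire g)) (horizontal ϱ).variation) ∧
        (∀ x, Integrable (gammaIntegrand m x) ϱ.variation) ∧
        ∃ T : Fock n →L[ℂ] Fock n,
          (∀ (f : Fock n) (z : Fin n → ℂ),
            entire (T f) z = realCoderivForm (horizontal ϱ) m (entire f) (kernel z)) ∧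
          (∀ f g : Fock n, inner ℂ g (T f) = realCoderivForm (horizontal ϱ) m (entire f) (entire g)) ∧
          IsDiagonalizedBy B T (gammaFn ϱ m)) ∧
      -- the case of a bounded operator that the form determines on the kernel functions
      ((∀ z : Fin n → ℂ, Integrable (fun w => ‖kernel z w‖ ^ 2 * Real.exp (-sqNorm w))
          (horizontal ϱ).variation) →
        (∀ x, Integrable (gammaIntegrand m x) ϱ.variation) ∧
        ∀ T : Fock n →L[ℂ] Fock n,
          (∀ (f : Fock n) (w : Fin n → ℂ), entire f = kernel w → ∀ z : Fin n → ℂ,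
            entire (T f) z = realCoderivForm (horizontal ϱ) m (kernel w) (kernel z)) →
          IsDiagonalizedBy B T (gammaFn ϱ m)) := by
  refine ⟨bargmann n, isBargmann_bargmann n, fun k m hm ϱ => ⟨fun h => ?_, fun h => ?_⟩⟩
  · have hϱ : HasGaussianMoments ϱ := hasGaussianMoments_of_kernel fun z => by
      have := h.integrable_sq (nonneg_of_cast_eq_two_mul hm) (kernelFock z)
      rwa [entire_kernelFock] at this
    obtain ⟨T, hT⟩ := h.exists_toeplitz hm
    have hTk : ∀ (f : Fock n) (z : Fin n → ℂ),
        entire (T f) z = realCoderivForm (horizontal ϱ) m (entire f) (kernel z) := fun f z => by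
      rw [← inner_kernelFock, hT, entire_kernelFock]
    refine ⟨fun f g β hβ => h.integrable_coderivIntegrand hm hβ f g,
      integrable_gammaIntegrand hϱ m, T, hTk, hT, isDiagonalizedBy_of_kernel hϱ m T fun w z => ?_⟩
    rw [hTk, entire_kernelFock]
  · have hϱ := hasGaussianMoments_of_kernel h
    exact ⟨integrable_gammaIntegrand hϱ m, fun T hT => isDiagonalizedBy_of_kernel hϱ m T fun w z =>
      hT _ w (entire_kernelFock w) z⟩
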